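/- Let $\sigma>0$ and $0<\alpha<1$, and let $\xi=(\xi_1,\xi_2,\dots)$ be a sequence of independent standard Gaussian variables. One observes $Y=S+\sigma\xi\in\mathbb R^\infty$; $\mathbf P_S$ denotes the law of $Y$, and $\mathbb S\subset\mathbb R^\infty$ is the set of signals $S$ with at most one non-zero component. Let $\bar\pi\ge 0$ be a bounded function on $(0,\infty)$ with $\int_0^\infty\bar\pi(x)\,dx=1$ and $\int_0^\infty\bar\pi(x)\log\frac1{\bar\pi(x)}\,dx$ finite, and put $\bar\pi_k^n=\bar\pi(k/n)\big/\sum_{s\ge1}\bar\pi(s/n)$ for $k\ge 1$. Assume that for all large $n$ the sum in the denominator is finite and positive, and that there is a constant $C$ such that for all large $n$ one has $\bar\pi_k^n\le C/n$ for every $k$ and $\sum_k\bar\pi_k^n\log\frac1{\bar\pi_k^n}\le\log n+C$. The Bayes test is $\varphi^\circ(Y)=\mathbf 1\bigl\{\sum_{k\ge1}\bar\pi_k^n\exp\bigl(Y_k^2/(2\sigma^2)\bigr)\ge t_n\bigr\}$, where for all large $n$ the critical value $t_n$ satisfies $\mathbf P\bigl\{\sum_{k\ge1}\bar\pi_k^n\exp(\xi_k^2/2)\ge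 t_n\bigr\}=\alpha$. Its error of the second kind is $\beta_{\varphi^\circ}(S)=\mathbf P_S\{\varphi^\circ(Y)=0\}$. Let $$\Pi^\circ_{\bar\pi^n}=\Bigl\{x\in\mathbb R^\infty:\ x_k^2\le 2\sigma^2\log\frac1{\bar\pi_k^n\sqrt{\pi\log n}}\ \text{ for all }k\Bigr\}$$ (no restriction on $x_k$ if $\bar\pi_k^n=0$). Then the limit below exists and $$\lim_{n\to\infty}\ \inf_{S\in\Pi^\circ_{\bar\pi^n}\cap\mathbb S}\beta_{\varphi^\circ}(S)\ \ge\ \frac{1-\alpha}2 .$$ Moreover, compare $\Pi^\circ_{\bar\pi^n}$, which does not depend on $\alpha$, with the parallelepiped of the maximum a posteriori test, whose squared $k$-th side is $$2\sigma^2\Bigl[\log\frac1{\bar\pi_k^n}+\log\frac1{\sqrt\pi\,\alpha}-\frac12\log\Bigl(\log\frac n{\sqrt\pi\,\alpha}\Bigr)\Bigr].$$ The squared $k$-th side of the latter minus the squared $k$-th side of $\Pi^\circ_{\bar\pi^n}$ tends to $2\sigma^2\log\frac1\alpha$ as $n\to\infty$, uniformly over the $k$ with $\bar\pi_k^n>0$.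 -/

import Mathlib

open Filter Topology MeasureTheory

noncomputable section

namespace Multichannel

/-- The space `ℝ^∞` of observations; channels are numbered `1, 2, …`. -/
abbrev Obs : Type := ℕ+ → ℝ

/-- The law of the discrete standard Gaussian white noise `ξ = (ξ₁, ξ₂, …)`. -/
def noise : Measure Obs :=
  Measure.infinitePi (fun _ : ℕ+ => ProbabilityTheory.gaussianReal 0 1)

/-- The law `P_S` of the observation `Y = S + σ ξ` for a fixed signal `S`. -/
def obsLaw (σ : ℝ) (S : Obs) : Measure Obs :=
  noise.map (fun ξ k => S k + σ * ξ k)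

/-- The set of signals that are zero in all channels except possibly the `k`-th one. -/
def channelSignals (k : ℕ+) : Set Obs := {S | ∀ i, i ≠ k → S i = 0}

/-- The set of all signals with at most one non-zero component. -/
def signals : Set Obs := ⋃ k, channelSignals k

/-- The prior probabilities `π̄ₖⁿ = π̄(k/n) / ∑ₛ π̄(s/n)`. -/
def prior (p : ℝ → ℝ) (n : ℕ) (k : ℕ+) : ℝ :=
  p ((k : ℝ) / n) / ∑' s : ℕ+, p ((s : ℝ) / n)

/-- The statistic `∑ₖ qₖ exp(Yₖ² / (2σ²))` of the Bayes test with prior probabilities `q`,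
a sum of non-negative terms with values in `[0, ∞]`. -/
def bayesStat (q : ℕ+ → ℝ) (σ : ℝ) (Y : Obs) : ENNReal :=
  ∑' k : ℕ+, ENNReal.ofReal (q k * Real.exp (Y k ^ 2 / (2 * σ ^ 2)))

/-- The Bayes test with critical value `t`: it equals `1` (the alternative is accepted) if the
statistic is at least `t`, and `0` (the null hypothesis is accepted) otherwise. -/
def bayesTest (q : ℕ+ → ℝ) (σ t : ℝ) : Obs → ℝ :=
  Set.indicator {Y | ENNReal.ofReal t ≤ bayesStat q σ Y} 1

/-- `t` is a critical value of the Bayes test for the false alarm probability `α`: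
`P {∑ₖ qₖ exp(ξₖ² / 2) ≥ t} = α`. -/
def IsCriticalValue (q : ℕ+ → ℝ) (α t : ℝ) : Prop :=
  noise {ξ | ENNReal.ofReal t ≤ ∑' k : ℕ+, ENNReal.ofReal (q k * Real.exp (ξ k ^ 2 / 2))}
    = ENNReal.ofReal α

/-- The probability `β_φ(S) = P_S {φ(Y) = 0}` of the error of the second kind of a test `φ`. -/
def secondKindError (σ : ℝ) (φ : Obs → ℝ) (S : Obs) : ℝ :=
  (obsLaw σ S).real {Y | φ Y = 0}

/-- The squared `k`-th side `2σ² log (1 / (qₖ √(π log n)))` of the parallelepiped for the Bayes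
test (meaningful for `qₖ > 0`). -/
def bayesSideSq (q : ℕ+ → ℝ) (σ : ℝ) (n : ℕ) (k : ℕ+) : ℝ :=
  2 * σ ^ 2 * Real.log (1 / (q k * Real.sqrt (Real.pi * Real.log n)))

/-- The parallelepiped `{x | ∀ k, xₖ² ≤ 2σ² log (1 / (qₖ √(π log n)))}` in `ℝ^∞`.
For `qₖ = 0` the bound is `log (1 / 0) = +∞`, that is, `xₖ` is not restricted. -/
def bayesBox (q : ℕ+ → ℝ) (σ : ℝ) (n : ℕ) : Set Obs :=
  {x | ∀ k, 0 < q k → x k ^ 2 ≤ bayesSideSq q σ n k}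

/-- The squared `k`-th side of the parallelepiped for the maximum a posteriori test,
`2σ² [log (1 / qₖ) + log (1 / (√π α)) - (1/2) log (log (n / (√π α)))]`
(meaningful for `qₖ > 0`). -/
def mapSideSq (q : ℕ+ → ℝ) (σ α : ℝ) (n : ℕ) (k : ℕ+) : ℝ :=
  2 * σ ^ 2 * (Real.log (1 / q k) + Real.log (1 / (Real.sqrt Real.pi * α))
    - 1 / 2 * Real.log (Real.log (n / (Real.sqrt Real.pi * α))))

end Multichannel

end

namespace Multichannel

open ProbabilityTheory Real

/-! Put `Λ = log n`. The limit equals `(1 - α) / 2` exactly: a signal on the boundary of the box is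
missed when two nearly independent events occur, the noise statistic staying below the critical
value (probability `1 - α`) and the noise in the signal channel pulling its term down (probability
about `1/2`).

The main point is anti-concentration of `∑ qₖ exp(ξₖ²/2)` at scale `1/√Λ`
(`exists_noise_expStat_mem_Ico_le`). A term exceeds `h` with probability of order `qₖ / (h √(log
(1/qₖ)))`; the entropy bound makes these sum to order `1/(h√Λ)`. For `h = κ/√Λ` with small `κ`, some
term therefore exceeds `h` with probability close to 1. Beyond `h` that term has density at most `qₖ
/ (h² √(2 log (h/qₖ)))`, so given the other channels the sum is unlikely to fall in a window of
length `δ/√Λ`. Hence a term of size `δ/√Λ` can be added or removed at cost `ε`.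

A signal in the box has signal-to-noise ratio `s` with `s² ≤ 2B`, where `B = log (1/(qₖ √(πΛ))) ≥
Λ/2`. The term is at most `δ/√Λ` iff `(s + z)² ≤ 2B + O(1)`, and it reaches `t` iff `(s + z)² ≥ 2B +
O(log Λ)` at most, because `t = O(Λ)` (`eventually_isCriticalValue_le`). On the scale of `s + z`
both corrections are `O(log Λ / √Λ)`, so on the boundary only the sign of `z` matters in the limit.
This gives the matching bounds `eventually_le_noise_shiftedStat_lt` and
`eventually_noise_shiftedStat_lt_le`. -/

/-! ### Estimates for one standard Gaussian variable -/

lemma two_le_sqrt_two_pi : 2 ≤ √(2 * π) := by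
  apply Real.le_sqrt_of_sq_le
  nlinarith [Real.pi_gt_three]

lemma gaussianPDFReal_std (x : ℝ) :
    gaussianPDFReal 0 1 x = (√(2 * π))⁻¹ * exp (-x ^ 2 / 2) := by
  simp [gaussianPDFReal]

/-- The standard Gaussian measure of an interval on which `|x| ≥ m`. -/
lemma gaussian_Icc_le {a b m : ℝ} (hab : a ≤ b) (hm : 0 ≤ m) (h : ∀ x ∈ Set.Icc a b, m ≤ |x|) :
    (gaussianReal 0 1).real (Set.Icc a b) ≤ (b - a) * (exp (-m ^ 2 / 2) / 2) := by
  have h2 := two_le_sqrt_two_pi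
  refine ENNReal.toReal_le_of_le_ofReal (by have := sub_nonneg.2 hab; positivity) ?_
  rw [gaussianReal_apply _ one_ne_zero]
  calc ∫⁻ x in Set.Icc a b, gaussianPDF 0 1 x
      ≤ ∫⁻ x in Set.Icc a b, ENNReal.ofReal (exp (-m ^ 2 / 2) / 2) := by
        refine setLIntegral_mono' measurableSet_Icc fun x hx => ENNReal.ofReal_le_ofReal ?_
        have hmx : m ^ 2 ≤ x ^ 2 := by
          rw [← sq_abs x]; exact pow_le_pow_left₀ hm (h x hx) 2
        calc gaussianPDFReal 0 1 x = (√(2 * π))⁻¹ * exp (-x ^ 2 / 2) := gaussianPDFReal_std x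
          _ ≤ 2⁻¹ * exp (-m ^ 2 / 2) := by gcongr
          _ = exp (-m ^ 2 / 2) / 2 := by ring
    _ = ENNReal.ofReal ((b - a) * (exp (-m ^ 2 / 2) / 2)) := by
        rw [setLIntegral_const, Real.volume_Icc, ← ENNReal.ofReal_mul (by positivity), mul_comm]

lemma gaussian_abs_mem_Icc_le {a b : ℝ} (ha : 0 ≤ a) (hab : a ≤ b) :
    (gaussianReal 0 1).real {z | a ≤ |z| ∧ |z| ≤ b} ≤ (b - a) * exp (-a ^ 2 / 2) := by
  have hsub : {z : ℝ | a ≤ |z| ∧ |z| ≤ b} ⊆ Set.Icc a b ∪ Set.Icc (-b) (-a) := by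
    rintro z ⟨h1, h2⟩
    rcases le_total 0 z with hz | hz
    · rw [abs_of_nonneg hz] at h1 h2
      exact Or.inl ⟨h1, h2⟩
    · rw [abs_of_nonpos hz] at h1 h2
      exact Or.inr ⟨by linarith, by linarith⟩
  have h1 := gaussian_Icc_le hab ha fun x hx => hx.1.trans (le_abs_self x)
  have h2 := gaussian_Icc_le (neg_le_neg hab) ha fun x hx => by
    have := neg_abs_le x
    have := neg_le_abs x
    linarith [hx.2]
  calc _ ≤ _ := measureReal_mono hsub
    _ ≤ _ := measureReal_union_le _ _
    _ ≤ _ := by linarith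

/-- A lower bound for the Gaussian tail. -/
lemma le_gaussian_abs_ge {a : ℝ} (ha : 1 ≤ a) :
    (√(2 * π))⁻¹ * exp (-3 / 2) * exp (-a ^ 2 / 2) / a ≤
      (gaussianReal 0 1).real {z | a ≤ |z|} := by
  have ha0 : 0 < a := by linarith
  -- On this interval `x² ≤ a² + 3`, whence the factor `exp (-3/2)`.
  have hsub : Set.Icc a (a + 1 / a) ⊆ {z : ℝ | a ≤ |z|} := fun z hz => hz.1.trans (le_abs_self z)
  refine le_trans ?_ (measureReal_mono hsub)
  refine (ENNReal.ofReal_le_iff_le_toReal (measure_ne_top _ _)).1 ?_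
  rw [gaussianReal_apply _ one_ne_zero]
  calc ENNReal.ofReal ((√(2 * π))⁻¹ * exp (-3 / 2) * exp (-a ^ 2 / 2) / a)
      = ∫⁻ x in Set.Icc a (a + 1 / a),
          ENNReal.ofReal ((√(2 * π))⁻¹ * exp (-3 / 2) * exp (-a ^ 2 / 2)) := by
        rw [setLIntegral_const, Real.volume_Icc, ← ENNReal.ofReal_mul (by positivity)]
        congr 1
        ring
    _ ≤ ∫⁻ x in Set.Icc a (a + 1 / a), gaussianPDF 0 1 x := by
        refine setLIntegral_mono' measurableSet_Icc fun x hx => ENNReal.ofReal_le_ofReal ?_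
        rw [gaussianPDFReal_std, mul_assoc, ← exp_add]
        have h1 : x ^ 2 ≤ (a + 1 / a) ^ 2 := pow_le_pow_left₀ (ha0.le.trans hx.1) hx.2 2
        have h2 : (a + 1 / a) ^ 2 = a ^ 2 + 2 + (1 / a) ^ 2 := by field_simp; ring
        have h3 : (1 / a) ^ 2 ≤ 1 := by
          rw [sq_le_one_iff₀ (by positivity), div_le_one ha0]; exact ha
        gcongr
        linarith

/-- A Chernoff bound for the Gaussian tail. -/
lemma gaussian_abs_ge_le {a : ℝ} (ha : 0 ≤ a) :
    (gaussianReal 0 1).real {z | a ≤ |z|} ≤ 2 * exp (-a ^ 2 / 2) := by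
  have h1 : (gaussianReal 0 1).real {z : ℝ | a ≤ z} ≤ exp (-a ^ 2 / 2) := by
    have := measure_ge_le_exp_mul_mgf (μ := gaussianReal 0 1) (X := fun z : ℝ => z) (t := a) a ha
      (integrable_exp_mul_gaussianReal a)
    refine this.trans_eq ?_
    rw [mgf_fun_id_gaussianReal, ← exp_add]
    congr 1
    push_cast
    ring
  have h2 : (gaussianReal 0 1).real {z : ℝ | z ≤ -a} ≤ exp (-a ^ 2 / 2) := by
    have := measure_le_le_exp_mul_mgf (μ := gaussianReal 0 1) (X := fun z : ℝ => z) (t := -a) (-a)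
      (by linarith) (integrable_exp_mul_gaussianReal (-a))
    refine this.trans_eq ?_
    rw [mgf_fun_id_gaussianReal, ← exp_add]
    congr 1
    push_cast
    ring
  have hsub : {z : ℝ | a ≤ |z|} ⊆ {z : ℝ | a ≤ z} ∪ {z : ℝ | z ≤ -a} := by
    intro z (hz : a ≤ |z|)
    rcases le_abs'.1 hz with h | h
    · exact Or.inr h
    · exact Or.inl h
  calc _ ≤ _ := measureReal_mono hsub
    _ ≤ _ := measureReal_union_le _ _
    _ ≤ _ := by linarith

/-- The truncated mean of `exp (z² / 2)`. -/
lemma lintegral_exp_sq_half_le {b : ℝ} (hb : 0 ≤ b) :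
    ∫⁻ z in {z : ℝ | |z| ≤ b}, ENNReal.ofReal (exp (z ^ 2 / 2)) ∂(gaussianReal 0 1)
      ≤ ENNReal.ofReal b := by
  have h2 := two_le_sqrt_two_pi
  have hset : {z : ℝ | |z| ≤ b} = Set.Icc (-b) b := by ext z; simp [abs_le]
  rw [hset, gaussianReal_of_var_ne_zero _ one_ne_zero,
    setLIntegral_withDensity_eq_setLIntegral_mul _ (measurable_gaussianPDF 0 1) (by fun_prop)
      measurableSet_Icc]
  calc ∫⁻ x in Set.Icc (-b) b, (gaussianPDF 0 1 * fun z => ENNReal.ofReal (exp (z ^ 2 / 2))) x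
      = ∫⁻ x in Set.Icc (-b) b, ENNReal.ofReal (√(2 * π))⁻¹ := by
        refine setLIntegral_congr_fun measurableSet_Icc fun x _ => ?_
        simp only [Pi.mul_apply, gaussianPDF]
        rw [gaussianPDFReal_std, ← ENNReal.ofReal_mul (by positivity), mul_assoc, ← exp_add]
        congr 1
        rw [show -x ^ 2 / 2 + x ^ 2 / 2 = 0 by ring]
        simp
    _ = ENNReal.ofReal ((√(2 * π))⁻¹ * (b - -b)) := by
        rw [setLIntegral_const, Real.volume_Icc, ← ENNReal.ofReal_mul (by positivity)]
    _ ≤ ENNReal.ofReal b := by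
        apply ENNReal.ofReal_le_ofReal
        have : (√(2 * π))⁻¹ ≤ 2⁻¹ := inv_anti₀ (by norm_num) h2
        nlinarith

lemma gaussian_Iic_zero : (gaussianReal 0 1).real (Set.Iic 0) = 1 / 2 := by
  have hneg : (gaussianReal 0 1).real (Set.Ici 0) = (gaussianReal 0 1).real (Set.Iic 0) := by
    have h : (gaussianReal 0 1).map (fun x : ℝ => -x) = gaussianReal 0 1 := by
      rw [gaussianReal_map_neg, neg_zero]
    conv_lhs => rw [← h]
    rw [map_measureReal_apply (by fun_prop) measurableSet_Ici]
    congr 1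
    ext x
    simp
  have : NullSingletonClass (gaussianReal 0 1) := nullSingletonClass_gaussianReal one_ne_zero
  have hc := probReal_compl_eq_one_sub (μ := gaussianReal 0 1) (s := Set.Iic (0 : ℝ))
    measurableSet_Iic
  rw [Set.compl_Iic, measureReal_congr Ioi_ae_eq_Ici, hneg] at hc
  linarith

lemma gaussian_Iic_le {r : ℝ} (hr : 0 ≤ r) :
    (gaussianReal 0 1).real (Set.Iic r) ≤ 1 / 2 + r := by
  have hsub : Set.Iic r ⊆ Set.Iic 0 ∪ Set.Icc 0 r := by
    intro z hz
    rcases le_total z 0 with h | h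
    · exact Or.inl h
    · exact Or.inr ⟨h, hz⟩
  have h := gaussian_Icc_le hr le_rfl fun x _ => abs_nonneg x
  have h' : (r - 0) * (exp (-0 ^ 2 / 2) / 2) ≤ r := by norm_num; linarith
  calc _ ≤ _ := measureReal_mono hsub
    _ ≤ _ := measureReal_union_le _ _
    _ ≤ _ := by rw [gaussian_Iic_zero]; linarith

/-- The negative half-line carries mass `1/2`; what is lost is a short interval next to `0` and the
tail beyond `u`. -/
lemma le_gaussian_Icc {u r : ℝ} (hu : 0 ≤ u) (hr : 0 ≤ r) :
    1 / 2 - r - 2 * exp (-u ^ 2 / 2) ≤ (gaussianReal 0 1).real (Set.Icc (-u) (-r)) := by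
  have hsub : Set.Iic (0 : ℝ) ⊆ (Set.Icc (-u) (-r) ∪ Set.Icc (-r) 0) ∪ {z | u ≤ |z|} := by
    intro z (hz : z ≤ 0)
    rcases le_total z (-r) with h | h
    · rcases le_total (-u) z with h' | h'
      · exact Or.inl (Or.inl ⟨h', h⟩)
      · refine Or.inr ?_
        show u ≤ |z|
        rw [abs_of_nonpos hz]
        linarith
    · exact Or.inl (Or.inr ⟨h, hz⟩)
  have h := gaussian_Icc_le (neg_nonpos.2 hr) le_rfl fun x _ => abs_nonneg x
  have h' : (0 - -r) * (exp (-0 ^ 2 / 2) / 2) ≤ r := by norm_num; linarith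
  have h1 := measureReal_mono (μ := gaussianReal 0 1) hsub
  have h2 := measureReal_union_le (μ := gaussianReal 0 1)
    (Set.Icc (-u) (-r) ∪ Set.Icc (-r) 0) {z | u ≤ |z|}
  have h3 := measureReal_union_le (μ := gaussianReal 0 1) (Set.Icc (-u) (-r)) (Set.Icc (-r) 0)
  have h4 := gaussian_abs_ge_le hu
  rw [gaussian_Iic_zero] at h1
  linarith

/-! ### Separating one channel of the noise from the others -/

instance isProbabilityMeasure_noise : IsProbabilityMeasure noise := by
  unfold noise; infer_instance

/-- The noise is invariant under resampling of one channel. -/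
lemma measurePreserving_update (k : ℕ+) :
    MeasurePreserving (fun x : Obs × ℝ => Function.update x.1 k x.2)
      (noise.prod (gaussianReal 0 1)) noise := by
  have hmeas : Measurable (fun x : Obs × ℝ => Function.update x.1 k x.2) := measurable_update'
  refine ⟨hmeas, ?_⟩
  refine Measure.eq_infinitePi _ fun s t ht => ?_
  have hs : MeasurableSet (Set.pi (s : Set ℕ+) t) :=
    MeasurableSet.pi s.countable_toSet fun i _ => ht i
  rw [Measure.map_apply hmeas hs]
  by_cases hk : k ∈ s
  · have : (fun x : Obs × ℝ => Function.update x.1 k x.2) ⁻¹' (Set.pi (s : Set ℕ+) t)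
        = (Set.pi ((s.erase k : Finset ℕ+) : Set ℕ+) t) ×ˢ t k := by
      ext ⟨ξ, z⟩
      simp only [Set.mem_preimage, Set.mem_pi, Finset.mem_coe, Set.mem_prod, Finset.mem_erase]
      constructor
      · intro h
        refine ⟨fun i hi => ?_, ?_⟩
        · simpa [Function.update_of_ne hi.1] using h i hi.2
        · simpa using h k hk
      · rintro ⟨h1, h2⟩ i hi
        by_cases hik : i = k
        · subst hik; simpa using h2
        · simpa [Function.update_of_ne hik] using h1 i ⟨hik, hi⟩
    rw [this, Measure.prod_prod, noise, Measure.infinitePi_pi _ fun i _ => ht i,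
      Finset.prod_erase_mul _ _ hk]
  · have : (fun x : Obs × ℝ => Function.update x.1 k x.2) ⁻¹' (Set.pi (s : Set ℕ+) t)
        = (Set.pi (s : Set ℕ+) t) ×ˢ Set.univ := by
      ext ⟨ξ, z⟩
      simp only [Set.mem_preimage, Set.mem_pi, Finset.mem_coe, Set.mem_prod, Set.mem_univ, and_true]
      refine forall₂_congr fun i hi => ?_
      rw [Function.update_of_ne (by rintro rfl; exact hk hi)]
    rw [this, Measure.prod_prod, noise, Measure.infinitePi_pi _ fun i _ => ht i, measure_univ,
      mul_one]

lemma noise_eq_lintegral (k : ℕ+) {A : Set Obs} (hA : MeasurableSet A) :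
    noise A = ∫⁻ ξ, gaussianReal 0 1 {z | Function.update ξ k z ∈ A} ∂noise := by
  rw [← (measurePreserving_update k).measure_preimage hA.nullMeasurableSet,
    Measure.prod_apply ((measurePreserving_update k).measurable hA)]
  rfl

/-- An event that does not depend on the `k`-th channel is independent of the `k`-th channel. -/
lemma noise_real_inter (k : ℕ+) {A : Set Obs} {B : Set ℝ} (hA : MeasurableSet A)
    (hB : MeasurableSet B) (hAk : ∀ ξ z, Function.update ξ k z ∈ A ↔ ξ ∈ A) :
    noise.real {ξ | ξ ∈ A ∧ ξ k ∈ B} = noise.real A * (gaussianReal 0 1).real B := by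
  have hm : MeasurableSet {ξ : Obs | ξ ∈ A ∧ ξ k ∈ B} :=
    hA.inter (measurable_pi_apply k hB)
  rw [measureReal_def, ← (measurePreserving_update k).measure_preimage hm.nullMeasurableSet]
  have : (fun x : Obs × ℝ => Function.update x.1 k x.2) ⁻¹' {ξ : Obs | ξ ∈ A ∧ ξ k ∈ B}
      = A ×ˢ B := by
    ext ⟨ξ, z⟩
    simp [hAk]
  rw [this, Measure.prod_prod, ENNReal.toReal_mul]
  rfl

lemma noise_eval (k : ℕ+) {B : Set ℝ} (hB : MeasurableSet B) :
    noise {ξ | ξ k ∈ B} = gaussianReal 0 1 B :=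
  (measurePreserving_eval_infinitePi (fun _ : ℕ+ => gaussianReal 0 1) k).measure_preimage
    hB.nullMeasurableSet

lemma lintegral_eval_noise (k : ℕ+) {f : ℝ → ENNReal} (hf : Measurable f) :
    ∫⁻ z, f z ∂(gaussianReal 0 1) = ∫⁻ ξ, f (ξ k) ∂noise :=
  ((measurePreserving_eval_infinitePi (fun _ : ℕ+ => gaussianReal 0 1) k).lintegral_comp hf).symm

/-! ### The noise statistic and its terms -/

/-- The statistic `∑ₖ qₖ exp (ξₖ² / 2)` of the Bayes test at the noise `ξ`. -/
noncomputable def expStat (q : ℕ+ → ℝ) (ξ : Obs) : ENNReal :=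
  ∑' k : ℕ+, ENNReal.ofReal (q k * exp (ξ k ^ 2 / 2))

/-- The statistic `expStat` without its `k`-th term. -/
noncomputable def expStatExcept (q : ℕ+ → ℝ) (k : ℕ+) (ξ : Obs) : ENNReal :=
  ∑' i : ℕ+, if i = k then 0 else ENNReal.ofReal (q i * exp (ξ i ^ 2 / 2))

@[fun_prop]
lemma measurable_expStat (q : ℕ+ → ℝ) : Measurable (expStat q) :=
  Measurable.tsum fun k => by fun_prop

@[fun_prop]
lemma measurable_expStatExcept (q : ℕ+ → ℝ) (k : ℕ+) : Measurable (expStatExcept q k) := by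
  refine Measurable.tsum fun i => ?_
  split_ifs
  · fun_prop
  · fun_prop

lemma expStat_eq_add (q : ℕ+ → ℝ) (k : ℕ+) (ξ : Obs) :
    expStat q ξ = ENNReal.ofReal (q k * exp (ξ k ^ 2 / 2)) + expStatExcept q k ξ := by
  rw [expStat, ENNReal.tsum_eq_add_tsum_ite k, expStatExcept]
  congr!

lemma expStatExcept_update (q : ℕ+ → ℝ) (k : ℕ+) (ξ : Obs) (z : ℝ) :
    expStatExcept q k (Function.update ξ k z) = expStatExcept q k ξ := by
  refine tsum_congr fun i => ?_
  split_ifs with h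
  · rfl
  · rw [Function.update_of_ne h]

lemma expStatExcept_le (q : ℕ+ → ℝ) (k : ℕ+) (ξ : Obs) : expStatExcept q k ξ ≤ expStat q ξ := by
  rw [expStat_eq_add q k]
  exact le_add_self

lemma le_mul_exp_iff {q h z : ℝ} (hq : 0 < q) (hh : q ≤ h) :
    h ≤ q * exp (z ^ 2 / 2) ↔ √(2 * log (h / q)) ≤ |z| := by
  have hh0 : 0 < h := hq.trans_le hh
  rw [Real.sqrt_le_left (abs_nonneg z), sq_abs, ← div_le_iff₀' hq,
    ← Real.log_le_iff_le_exp (by positivity), le_div_iff₀ (by norm_num), mul_comm]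

lemma mul_exp_lt_iff {q h z : ℝ} (hq : 0 < q) (hh : q ≤ h) :
    q * exp (z ^ 2 / 2) < h ↔ |z| < √(2 * log (h / q)) := by
  rw [← not_le, le_mul_exp_iff hq hh, not_le]

lemma exp_neg_sqrt_log {q h : ℝ} (hq : 0 < q) (hh : q ≤ h) :
    exp (-√(2 * log (h / q)) ^ 2 / 2) = q / h := by
  have hh0 : 0 < h := hq.trans_le hh
  rw [Real.sq_sqrt (by have := Real.log_nonneg ((one_le_div hq).2 hh); positivity)]
  rw [show -(2 * log (h / q)) / 2 = -log (h / q) by ring, Real.exp_neg,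
    Real.exp_log (by positivity), inv_div]

/-! ### Anti-concentration of the statistic -/

/-- The distribution of `q exp (z² / 2)` beyond a level `h > q` has density at most
`q / (h² √(2 log (h / q)))`. -/
lemma gaussian_mul_exp_mem_Ico_le {q h y η : ℝ} (hq : 0 < q) (hqh : q < h) (hy : h ≤ y)
    (hη : 0 ≤ η) :
    (gaussianReal 0 1).real {z | y ≤ q * exp (z ^ 2 / 2) ∧ q * exp (z ^ 2 / 2) < y + η} ≤
      η / h ^ 2 * (q / √(2 * log (h / q))) := by
  have hh0 : 0 < h := hq.trans hqh
  have hy0 : 0 < y := hh0.trans_le hy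
  set a := √(2 * log (y / q)) with ha
  set b := √(2 * log ((y + η) / q)) with hb
  have hlogh : 0 < log (h / q) := Real.log_pos ((one_lt_div hq).2 hqh)
  have hlogy : log (h / q) ≤ log (y / q) := by gcongr
  have hah : √(2 * log (h / q)) ≤ a := Real.sqrt_le_sqrt (by linarith)
  have hh1 : 0 < √(2 * log (h / q)) := by positivity
  have ha0 : 0 < a := hh1.trans_le hah
  have hab : a ≤ b := by
    rw [ha, hb]; gcongr; linarith
  have hsub : {z : ℝ | y ≤ q * exp (z ^ 2 / 2) ∧ q * exp (z ^ 2 / 2) < y + η} ⊆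
      {z | a ≤ |z| ∧ |z| ≤ b} := fun z hz =>
    ⟨(le_mul_exp_iff hq (by linarith)).1 hz.1, ((mul_exp_lt_iff hq (by linarith)).1 hz.2).le⟩
  -- Here `b² - a² = 2 log ((y + η)/y) ≤ 2η/y`, while `b + a ≥ 2a`.
  have hba : b - a ≤ η / (y * a) := by
    have h1 : (b - a) * (b + a) = 2 * log ((y + η) / y) := by
      have hb2 : b ^ 2 = 2 * log ((y + η) / q) :=
        Real.sq_sqrt (by
          have : 0 ≤ log ((y + η) / q) := Real.log_nonneg ((one_le_div hq).2 (by linarith))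
          positivity)
      have ha2 : a ^ 2 = 2 * log (y / q) := Real.sq_sqrt (by linarith)
      have : (b - a) * (b + a) = b ^ 2 - a ^ 2 := by ring
      rw [this, hb2, ha2, Real.log_div (by linarith) hq.ne', Real.log_div hy0.ne' hq.ne',
        Real.log_div (by linarith) hy0.ne']
      ring
    have h2 : log ((y + η) / y) ≤ η / y := by
      have := Real.log_le_sub_one_of_pos (x := (y + η) / y) (by positivity)
      have h3 : (y + η) / y - 1 = η / y := by field_simp; ring
      rwa [h3] at this
    rw [← div_div, le_div_iff₀ ha0]
    nlinarith [mul_nonneg (sub_nonneg.2 hab) (sub_nonneg.2 hab)]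
  calc _ ≤ _ := measureReal_mono hsub
    _ ≤ (b - a) * exp (-a ^ 2 / 2) := gaussian_abs_mem_Icc_le ha0.le hab
    _ = (b - a) * (q / y) := by rw [ha, exp_neg_sqrt_log hq (by linarith)]
    _ ≤ η / (y * a) * (q / y) := by gcongr
    _ = η / y ^ 2 * (q / a) := by field_simp
    _ ≤ η / h ^ 2 * (q / √(2 * log (h / q))) := by gcongr

/-- The constant `w` stands for the frozen sum of the other terms. It only translates the window,
and the density bound beyond `h` does not depend on the window's position. -/
lemma gaussian_add_mul_exp_mem_Ico_le {q h η : ℝ} (hq : 0 < q) (hqh : q < h)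
    (hη : 0 ≤ η) (x : ℝ) (w : ENNReal) :
    (gaussianReal 0 1).real {z | ENNReal.ofReal x ≤ ENNReal.ofReal (q * exp (z ^ 2 / 2)) + w ∧
        ENNReal.ofReal (q * exp (z ^ 2 / 2)) + w < ENNReal.ofReal (x + η) ∧
        h ≤ q * exp (z ^ 2 / 2)} ≤
      η / h ^ 2 * (q / √(2 * log (h / q))) := by
  refine le_trans (measureReal_mono ?_)
    (gaussian_mul_exp_mem_Ico_le hq hqh (le_max_right (x - w.toReal) h) hη)
  rintro z ⟨h1, h2, h3⟩
  have hw : w ≠ ⊤ := fun hw => by simp [hw] at h2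
  lift w to NNReal using hw
  have hpos : 0 ≤ q * exp (z ^ 2 / 2) := by positivity
  have hsum : ENNReal.ofReal (q * exp (z ^ 2 / 2)) + (w : ENNReal)
      = ENNReal.ofReal (q * exp (z ^ 2 / 2) + w) := by
    rw [ENNReal.ofReal_add hpos w.coe_nonneg, ENNReal.ofReal_coe_nnreal]
  rw [hsum] at h1 h2
  rw [ENNReal.ofReal_le_ofReal_iff (by positivity)] at h1
  have h2' := (ENNReal.ofReal_lt_ofReal_iff_of_nonneg (by positivity)).1 h2
  simp only [ENNReal.coe_toReal, Set.mem_ofPred_eq]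
  refine ⟨max_le (by linarith) h3, ?_⟩
  have := le_max_left (x - w) h
  linarith

lemma noise_mem_Ico_of_large_term_le {q : ℕ+ → ℝ} {k : ℕ+} {h η : ℝ} (hq : 0 < q k)
    (hqh : q k < h) (hη : 0 ≤ η) (x : ℝ) :
    noise {ξ | ENNReal.ofReal x ≤ expStat q ξ ∧ expStat q ξ < ENNReal.ofReal (x + η) ∧
        h ≤ q k * exp (ξ k ^ 2 / 2)} ≤
      ENNReal.ofReal (η / h ^ 2 * (q k / √(2 * log (h / q k)))) := by
  have hm : MeasurableSet {ξ : Obs | ENNReal.ofReal x ≤ expStat q ξ ∧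
      expStat q ξ < ENNReal.ofReal (x + η) ∧ h ≤ q k * exp (ξ k ^ 2 / 2)} := by
    have h1 : MeasurableSet {ξ : Obs | ENNReal.ofReal x ≤ expStat q ξ} :=
      measurableSet_le (by fun_prop) (by fun_prop)
    have h2 : MeasurableSet {ξ : Obs | expStat q ξ < ENNReal.ofReal (x + η)} :=
      measurableSet_lt (by fun_prop) (by fun_prop)
    have h3 : MeasurableSet {ξ : Obs | h ≤ q k * exp (ξ k ^ 2 / 2)} :=
      measurableSet_le (by fun_prop) (by fun_prop)
    exact h1.inter (h2.inter h3)
  rw [noise_eq_lintegral k hm]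
  calc _ ≤ ∫⁻ _, ENNReal.ofReal (η / h ^ 2 * (q k / √(2 * log (h / q k)))) ∂noise := by
        refine lintegral_mono fun ξ => ?_
        have := gaussian_add_mul_exp_mem_Ico_le hq hqh hη x (expStatExcept q k ξ)
        rw [measureReal_def, ← ENNReal.le_ofReal_iff_toReal_le (measure_ne_top _ _)
          (measureReal_nonneg.trans this)] at this
        simpa only [Set.mem_ofPred_eq, expStat_eq_add q k, expStatExcept_update,
          Function.update_self] using this
    _ = _ := by simp

/-- A lower bound for the probability of a large term. -/
lemma le_gaussian_mul_exp_ge {q h m : ℝ} (hq : 0 < q) (hh : 0 < h) (hh1 : h ≤ 1)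
    (hqh : 1 ≤ log (h / q)) (hm : 0 < m) :
    (√(2 * π))⁻¹ * exp (-3 / 2) / √2 / (h * √m) * ((3 * q - q * log (1 / q) / m) / 2) ≤
      (gaussianReal 0 1).real {z | h ≤ q * exp (z ^ 2 / 2)} := by
  have hqlth : q ≤ h := by
    by_contra hcon
    have := Real.log_nonpos (x := h / q) (by positivity) ((div_le_one hq).2 (not_le.1 hcon).le)
    linarith
  have ha : 1 ≤ √(2 * log (h / q)) := Real.one_le_sqrt.2 (by linarith)
  have hset : {z : ℝ | h ≤ q * exp (z ^ 2 / 2)} = {z | √(2 * log (h / q)) ≤ |z|} := by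
    ext z; exact le_mul_exp_iff hq hqlth
  rw [hset]
  refine le_trans ?_ (le_gaussian_abs_ge ha)
  rw [exp_neg_sqrt_log hq hqlth]
  have hlog : log (h / q) ≤ log (1 / q) := by gcongr
  have hL : 0 < log (1 / q) := by linarith
  set y := √(log (1 / q)) with hy
  set r := √m with hr
  have hy0 : 0 < y := Real.sqrt_pos.2 hL
  have hr0 : 0 < r := Real.sqrt_pos.2 hm
  have hy2 : log (1 / q) = y ^ 2 := (Real.sq_sqrt hL.le).symm
  have hr2 : m = r ^ 2 := (Real.sq_sqrt hm.le).symm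
  have hsq : √(2 * log (h / q)) ≤ √2 * y := by
    rw [hy, ← Real.sqrt_mul (by norm_num)]; gcongr
  -- The convex function `u ↦ u^(-1/2)` lies above its tangent at `u = m`. This makes the bound
  -- linear in `log (1/q)`, so that summing over channels produces the entropy.
  have key : (3 - y ^ 2 / r ^ 2) / 2 / r ≤ 1 / y := by
    rw [div_div, div_le_div_iff₀ (by positivity) hy0]
    have : 0 ≤ (y - r) ^ 2 * (y + 2 * r) := by positivity
    have h3 : (3 - y ^ 2 / r ^ 2) * y = 1 * (2 * r) - (y - r) ^ 2 * (y + 2 * r) / r ^ 2 := by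
      field_simp; ring
    rw [h3]
    have : 0 ≤ (y - r) ^ 2 * (y + 2 * r) / r ^ 2 := by positivity
    linarith
  calc (√(2 * π))⁻¹ * exp (-3 / 2) / √2 / (h * r) * ((3 * q - q * log (1 / q) / m) / 2)
      = (√(2 * π))⁻¹ * exp (-3 / 2) * (q / h) / √2 * ((3 - y ^ 2 / r ^ 2) / 2 / r) := by
        rw [hy2, hr2]; field_simp
    _ ≤ (√(2 * π))⁻¹ * exp (-3 / 2) * (q / h) / √2 * (1 / y) := by gcongr
    _ = (√(2 * π))⁻¹ * exp (-3 / 2) * (q / h) / (√2 * y) := by field_simp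
    _ ≤ _ := by gcongr

/-- By independence the probability is at most `∏ (1 - pₖ)` over any finite set of channels, and `1
- p ≤ exp (-p)`. -/
lemma noise_no_large_term_le (q : ℕ+ → ℝ) (h : ℝ) (F : Finset ℕ+) :
    noise {ξ | ∀ k, q k * exp (ξ k ^ 2 / 2) < h} ≤
      ENNReal.ofReal (exp (-∑ k ∈ F, (gaussianReal 0 1).real {z | h ≤ q k * exp (z ^ 2 / 2)})) := by
  have hm : ∀ k, MeasurableSet {z : ℝ | h ≤ q k * exp (z ^ 2 / 2)} := fun k =>
    measurableSet_le (by fun_prop) (by fun_prop)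
  have hsub : {ξ : Obs | ∀ k, q k * exp (ξ k ^ 2 / 2) < h} ⊆
      Set.pi (F : Set ℕ+) fun k => {z : ℝ | h ≤ q k * exp (z ^ 2 / 2)}ᶜ := by
    intro ξ hξ k _
    simpa using hξ k
  refine (measure_mono hsub).trans ?_
  rw [noise, Measure.infinitePi_pi _ fun i _ => (hm i).compl, ← Finset.sum_neg_distrib,
    Real.exp_sum, ENNReal.ofReal_prod_of_nonneg fun i _ => (exp_pos _).le]
  refine Finset.prod_le_prod' fun k _ => ?_
  rw [← ofReal_measureReal, probReal_compl_eq_one_sub (hm k)]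
  exact ENNReal.ofReal_le_ofReal (Real.one_sub_le_exp_neg _)

/-- A bound on the concentration function of the statistic of the Bayes test: either no term
exceeds `h`, or one of the terms exceeds `h`, where its density is small. -/
theorem noise_expStat_mem_Ico_le {q : ℕ+ → ℝ} (hq0 : ∀ k, 0 ≤ q k) (hq1 : HasSum q 1)
    {m h l η : ℝ} (hm : 0 < m) (hent : Summable fun k => q k * log (1 / q k))
    (hentm : ∑' k, q k * log (1 / q k) ≤ m) (hh : 0 < h) (hh1 : h ≤ 1) (hl : 1 ≤ l)
    (hlq : ∀ k, 0 < q k → l ≤ log (h / q k)) (hη : 0 ≤ η) (x : ℝ) :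
    noise.real {ξ | ENNReal.ofReal x ≤ expStat q ξ ∧ expStat q ξ < ENNReal.ofReal (x + η)} ≤
      exp (-((√(2 * π))⁻¹ * exp (-3 / 2) / √2 / (h * √m) / 2)) + η / h ^ 2 / √(2 * l) := by
  have hqh : ∀ k, 0 < q k → q k < h := fun k hk => by
    by_contra hcon
    have := Real.log_nonpos (x := h / q k) (by positivity) ((div_le_one hk).2 (not_lt.1 hcon))
    linarith [hlq k hk]
  -- The full series sums to at least `(3 - 1)/2 = 1`, so some finite partial sum exceeds `1/2`.
  obtain ⟨F, hF⟩ : ∃ F : Finset ℕ+,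
      1 / 2 < ∑ k ∈ F, (3 * q k - q k * log (1 / q k) / m) / 2 := by
    have hs := (((hq1.mul_left 3).sub (hent.hasSum.div_const m)).div_const 2)
    refine (hs.eventually_const_lt ?_).exists
    have : (∑' k, q k * log (1 / q k)) / m ≤ 1 := (div_le_one hm).2 hentm
    linarith
  have hc : 0 ≤ (√(2 * π))⁻¹ * exp (-3 / 2) / √2 / (h * √m) := by positivity
  have hsmall : noise {ξ : Obs | ∀ k, q k * exp (ξ k ^ 2 / 2) < h} ≤
      ENNReal.ofReal (exp (-((√(2 * π))⁻¹ * exp (-3 / 2) / √2 / (h * √m) / 2))) := by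
    refine (noise_no_large_term_le q h F).trans (ENNReal.ofReal_le_ofReal (exp_le_exp.2 ?_))
    rw [neg_le_neg_iff]
    calc (√(2 * π))⁻¹ * exp (-3 / 2) / √2 / (h * √m) / 2
        = (√(2 * π))⁻¹ * exp (-3 / 2) / √2 / (h * √m) * (1 / 2) := by ring
      _ ≤ (√(2 * π))⁻¹ * exp (-3 / 2) / √2 / (h * √m) *
          ∑ k ∈ F, (3 * q k - q k * log (1 / q k) / m) / 2 := by gcongr
      _ ≤ _ := by
        rw [Finset.mul_sum]
        refine Finset.sum_le_sum fun k _ => ?_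
        rcases (hq0 k).eq_or_lt' with hk | hk
        · simp [hk, measureReal_nonneg]
        · exact le_gaussian_mul_exp_ge hk hh hh1 (hl.trans (hlq k hk)) hm
  have hlarge : ∀ k, noise {ξ : Obs | ENNReal.ofReal x ≤ expStat q ξ ∧
      expStat q ξ < ENNReal.ofReal (x + η) ∧ h ≤ q k * exp (ξ k ^ 2 / 2)} ≤
      ENNReal.ofReal (q k * (η / h ^ 2 / √(2 * l))) := by
    intro k
    rcases (hq0 k).eq_or_lt' with hk | hk
    · simp [hk, hh.not_ge]
    · refine (noise_mem_Ico_of_large_term_le hk (hqh k hk) hη x).trans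
        (ENNReal.ofReal_le_ofReal ?_)
      calc η / h ^ 2 * (q k / √(2 * log (h / q k))) ≤ η / h ^ 2 * (q k / √(2 * l)) := by
            gcongr; exact hlq k hk
        _ = _ := by ring
  have hcover : {ξ | ENNReal.ofReal x ≤ expStat q ξ ∧ expStat q ξ < ENNReal.ofReal (x + η)} ⊆
      {ξ : Obs | ∀ k, q k * exp (ξ k ^ 2 / 2) < h} ∪
      ⋃ k, {ξ : Obs | ENNReal.ofReal x ≤ expStat q ξ ∧
        expStat q ξ < ENNReal.ofReal (x + η) ∧ h ≤ q k * exp (ξ k ^ 2 / 2)} := by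
    intro ξ hξ
    by_cases hc : ∀ k, q k * exp (ξ k ^ 2 / 2) < h
    · exact Or.inl hc
    · push Not at hc
      obtain ⟨k, hk⟩ := hc
      exact Or.inr (Set.mem_iUnion.2 ⟨k, hξ.1, hξ.2, hk⟩)
  have hnn : 0 ≤ η / h ^ 2 / √(2 * l) := by positivity
  refine ENNReal.toReal_le_of_le_ofReal (by positivity) ?_
  calc _ ≤ _ := measure_mono hcover
    _ ≤ _ := measure_union_le _ _
    _ ≤ ENNReal.ofReal (exp (-((√(2 * π))⁻¹ * exp (-3 / 2) / √2 / (h * √m) / 2))) +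
        ∑' k, ENNReal.ofReal (q k * (η / h ^ 2 / √(2 * l))) := by
      gcongr
      exact (measure_iUnion_le _).trans (ENNReal.tsum_le_tsum hlarge)
    _ = _ := by
      rw [← ENNReal.ofReal_tsum_of_nonneg (fun k => mul_nonneg (hq0 k) hnn)
        (hq1.summable.mul_right _), tsum_mul_right, hq1.tsum_eq, one_mul,
        ← ENNReal.ofReal_add (exp_pos _).le hnn]

/-! ### Upper tail of the statistic -/

/-- The truncation of the `k`-th term of the Bayes statistic at the level `A`. -/
noncomputable def truncTerm (q A z : ℝ) : ENNReal :=
  Set.indicator {z : ℝ | q * exp (z ^ 2 / 2) < A} (fun z => ENNReal.ofReal (q * exp (z ^ 2 / 2))) z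

@[fun_prop]
lemma measurable_truncTerm (q A : ℝ) : Measurable (truncTerm q A) :=
  Measurable.indicator (by fun_prop) (measurableSet_lt (by fun_prop) (by fun_prop))

/-- The factor `exp (z²/2)` cancels the Gaussian density, so the truncated mean is at most `q` times
the cut-off `√(2 log (A/q))`; then `√(2x) ≤ 1/2 + x` brings it to entropy form. -/
lemma lintegral_truncTerm_le {q A : ℝ} (hq : 0 < q) (hA : 1 ≤ A) (hqA : q ≤ A) :
    ∫⁻ z, truncTerm q A z ∂(gaussianReal 0 1) ≤
      ENNReal.ofReal (q * (1 / 2 + log A) + q * log (1 / q)) := by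
  have hm : MeasurableSet {z : ℝ | q * exp (z ^ 2 / 2) < A} :=
    measurableSet_lt (by fun_prop) (by fun_prop)
  have hlog : 0 ≤ log (A / q) := Real.log_nonneg ((one_le_div hq).2 hqA)
  have hsub : {z : ℝ | q * exp (z ^ 2 / 2) < A} ⊆ {z | |z| ≤ √(2 * log (A / q))} :=
    fun z hz => ((mul_exp_lt_iff hq hqA).1 hz).le
  calc ∫⁻ z, truncTerm q A z ∂(gaussianReal 0 1)
      = ∫⁻ z in {z : ℝ | q * exp (z ^ 2 / 2) < A}, ENNReal.ofReal (q * exp (z ^ 2 / 2))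
          ∂(gaussianReal 0 1) := lintegral_indicator hm _
    _ ≤ ∫⁻ z in {z : ℝ | |z| ≤ √(2 * log (A / q))}, ENNReal.ofReal (q * exp (z ^ 2 / 2))
          ∂(gaussianReal 0 1) := lintegral_mono_set hsub
    _ = ENNReal.ofReal q * ∫⁻ z in {z : ℝ | |z| ≤ √(2 * log (A / q))},
          ENNReal.ofReal (exp (z ^ 2 / 2)) ∂(gaussianReal 0 1) := by
        rw [← lintegral_const_mul _ (by fun_prop)]
        simp_rw [ENNReal.ofReal_mul hq.le]
    _ ≤ ENNReal.ofReal q * ENNReal.ofReal √(2 * log (A / q)) := by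
        gcongr; exact lintegral_exp_sq_half_le (Real.sqrt_nonneg _)
    _ = ENNReal.ofReal (q * √(2 * log (A / q))) := (ENNReal.ofReal_mul hq.le).symm
    _ ≤ _ := by
        apply ENNReal.ofReal_le_ofReal
        have h1 : √(2 * log (A / q)) ≤ 1 / 2 + log (A / q) := by
          have := Real.sq_sqrt (show 0 ≤ 2 * log (A / q) by positivity)
          nlinarith [sq_nonneg (√(2 * log (A / q)) - 1)]
        have h2 : log (A / q) = log A + log (1 / q) := by
          rw [Real.log_div (by linarith) hq.ne', Real.log_div one_ne_zero hq.ne', Real.log_one]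
          ring
        rw [h2] at h1
        have := mul_le_mul_of_nonneg_left h1 hq.le
        rw [h2]
        linarith

/-- A tail bound for the statistic of the Bayes test, by truncation of its terms. -/
theorem noise_expStat_ge_le {q : ℕ+ → ℝ} (hq0 : ∀ k, 0 ≤ q k) (hq1 : HasSum q 1)
    {m A t : ℝ} (hent : Summable fun k => q k * log (1 / q k))
    (hentm : ∑' k, q k * log (1 / q k) ≤ m) (hA : 1 ≤ A) (ht : 0 < t) :
    noise {ξ | ENNReal.ofReal t ≤ expStat q ξ} ≤
      ENNReal.ofReal (2 / A) + ENNReal.ofReal ((1 / 2 + log A + m) / t) := by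
  have hqle : ∀ k, q k ≤ 1 := fun k => le_hasSum hq1 k fun i _ => hq0 i
  have hent0 : ∀ k, 0 ≤ q k * log (1 / q k) := fun k => by
    rcases (hq0 k).eq_or_lt' with hk | hk
    · simp [hk]
    · exact mul_nonneg (hq0 k) (Real.log_nonneg ((one_le_div hk).2 (hqle k)))
  have hlogA := Real.log_nonneg hA
  have hbig : ∀ k, noise {ξ : Obs | A ≤ q k * exp (ξ k ^ 2 / 2)} ≤
      ENNReal.ofReal (q k * (2 / A)) := by
    intro k
    rcases (hq0 k).eq_or_lt' with hk | hk
    · have : ¬ A ≤ 0 := by linarith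
      simp [hk, this]
    · have hqA : q k ≤ A := (hqle k).trans hA
      have hset : {ξ : Obs | A ≤ q k * exp (ξ k ^ 2 / 2)}
          = {ξ : Obs | ξ k ∈ {z : ℝ | √(2 * log (A / q k)) ≤ |z|}} := by
        ext ξ; exact le_mul_exp_iff hk hqA
      rw [hset, noise_eval k (measurableSet_le (by fun_prop) (by fun_prop)), ← ofReal_measureReal]
      apply ENNReal.ofReal_le_ofReal
      refine (gaussian_abs_ge_le (Real.sqrt_nonneg _)).trans_eq ?_
      rw [exp_neg_sqrt_log hk hqA]
      ring
  have hmean : ∀ k, ∫⁻ ξ, truncTerm (q k) A (ξ k) ∂noise ≤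
      ENNReal.ofReal (q k * (1 / 2 + log A) + q k * log (1 / q k)) := by
    intro k
    rcases (hq0 k).eq_or_lt' with hk | hk
    · simp [hk, truncTerm]
    · rw [← lintegral_eval_noise k (measurable_truncTerm (q k) A)]
      exact lintegral_truncTerm_le hk hA ((hqle k).trans hA)
  have hmk : 0 ≤ ∑' k, q k * log (1 / q k) := tsum_nonneg hent0
  -- Markov's inequality needs the truncation: an untruncated term with positive weight has infinite
  -- mean.
  have hmarkov : noise {ξ : Obs | ENNReal.ofReal t ≤ ∑' k, truncTerm (q k) A (ξ k)} ≤
      ENNReal.ofReal ((1 / 2 + log A + m) / t) := by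
    refine (meas_ge_le_lintegral_div ?_ (by simpa using ht) ENNReal.ofReal_ne_top).trans ?_
    · exact (Measurable.tsum fun k => by fun_prop).aemeasurable
    · have hmeas : ∀ k, Measurable fun ξ : Obs => truncTerm (q k) A (ξ k) := fun k =>
        (measurable_truncTerm (q k) A).comp (measurable_pi_apply k)
      rw [lintegral_tsum fun k => (hmeas k).aemeasurable, ENNReal.ofReal_div_of_pos ht]
      gcongr
      refine (ENNReal.tsum_le_tsum hmean).trans ?_
      rw [← ENNReal.ofReal_tsum_of_nonneg
        (fun k => add_nonneg (mul_nonneg (hq0 k) (by positivity)) (hent0 k))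
        ((hq1.summable.mul_right _).add hent)]
      apply ENNReal.ofReal_le_ofReal
      rw [(hq1.summable.mul_right _).tsum_add hent, tsum_mul_right, hq1.tsum_eq]
      linarith
  have hcover : {ξ | ENNReal.ofReal t ≤ expStat q ξ} ⊆
      (⋃ k, {ξ : Obs | A ≤ q k * exp (ξ k ^ 2 / 2)}) ∪
        {ξ : Obs | ENNReal.ofReal t ≤ ∑' k, truncTerm (q k) A (ξ k)} := by
    intro ξ hξ
    by_cases hc : ∃ k, A ≤ q k * exp (ξ k ^ 2 / 2)
    · exact Or.inl (Set.mem_iUnion.2 hc)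
    · push Not at hc
      refine Or.inr ?_
      have : ∑' k, truncTerm (q k) A (ξ k) = expStat q ξ :=
        tsum_congr fun k => Set.indicator_of_mem (s := {z : ℝ | q k * exp (z ^ 2 / 2) < A}) (hc k) _
      show ENNReal.ofReal t ≤ ∑' k, truncTerm (q k) A (ξ k)
      rw [this]
      exact hξ
  calc _ ≤ _ := measure_mono hcover
    _ ≤ _ := measure_union_le _ _
    _ ≤ ∑' k, ENNReal.ofReal (q k * (2 / A)) + ENNReal.ofReal ((1 / 2 + log A + m) / t) := by
      gcongr
      exact (measure_iUnion_le _).trans (ENNReal.tsum_le_tsum hbig)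
    _ = _ := by
      rw [← ENNReal.ofReal_tsum_of_nonneg (fun k => mul_nonneg (hq0 k) (by positivity))
        (hq1.summable.mul_right _), tsum_mul_right, hq1.tsum_eq, one_mul]

/-! ### Error of the second kind for a one-channel signal -/

/-- The statistic of the Bayes test with the signal-to-noise ratio `s` in the `k`-th channel. -/
noncomputable def shiftedStat (q : ℕ+ → ℝ) (k : ℕ+) (s : ℝ) (ξ : Obs) : ENNReal :=
  ENNReal.ofReal (q k * exp ((s + ξ k) ^ 2 / 2)) + expStatExcept q k ξ

lemma bayesStat_channelSignal (q : ℕ+ → ℝ) {σ : ℝ} (hσ : 0 < σ) {k : ℕ+} {S : Obs}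
    (hS : S ∈ channelSignals k) (ξ : Obs) :
    bayesStat q σ (fun i => S i + σ * ξ i) = shiftedStat q k (S k / σ) ξ := by
  rw [bayesStat, ENNReal.tsum_eq_add_tsum_ite k, shiftedStat, expStatExcept]
  congr 1
  · congr 3
    field_simp
  · refine tsum_congr fun i => ?_
    split_ifs with h
    · rfl
    · rw [hS i h]
      congr 3
      field_simp
      ring

lemma measurable_bayesStat (q : ℕ+ → ℝ) (σ : ℝ) : Measurable (bayesStat q σ) :=
  Measurable.tsum fun k => by fun_prop

lemma secondKindError_channelSignal (q : ℕ+ → ℝ) {σ : ℝ} (hσ : 0 < σ) (t : ℝ) {k : ℕ+} {S : Obs}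
    (hS : S ∈ channelSignals k) :
    secondKindError σ (bayesTest q σ t) S =
      noise.real {ξ | shiftedStat q k (S k / σ) ξ < ENNReal.ofReal t} := by
  have hset : {Y | bayesTest q σ t Y = 0} = {Y | bayesStat q σ Y < ENNReal.ofReal t} := by
    ext Y
    simp [bayesTest, Set.indicator_apply]
  rw [secondKindError, obsLaw, hset,
    map_measureReal_apply (by fun_prop)
      (measurableSet_lt (measurable_bayesStat q σ) measurable_const)]
  congr 1
  ext ξ
  show bayesStat q σ (fun i => S i + σ * ξ i) < _ ↔ _
  rw [bayesStat_channelSignal q hσ hS]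
  rfl

lemma mem_expStatExcept_lt_update (q : ℕ+ → ℝ) (k : ℕ+) (c : ENNReal) (ξ : Obs) (z : ℝ) :
    Function.update ξ k z ∈ {ξ | expStatExcept q k ξ < c} ↔ ξ ∈ {ξ | expStatExcept q k ξ < c} := by
  show expStatExcept q k (Function.update ξ k z) < c ↔ expStatExcept q k ξ < c
  rw [expStatExcept_update]

/-- The test misses the signal if the other channels sum to less than `t - η` and the signal term is
at most `η`. These events are independent, and dropping the `k`-th noise term only lowers the
statistic. -/
lemma le_noise_shiftedStat_lt (q : ℕ+ → ℝ) (k : ℕ+) (s t : ℝ) {η : ℝ} (hη : 0 ≤ η) :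
    noise.real {ξ | expStat q ξ < ENNReal.ofReal (t - η)} *
        (gaussianReal 0 1).real {z | q k * exp ((s + z) ^ 2 / 2) ≤ η} ≤
      noise.real {ξ | shiftedStat q k s ξ < ENNReal.ofReal t} := by
  have hA : MeasurableSet {ξ : Obs | expStatExcept q k ξ < ENNReal.ofReal (t - η)} :=
    measurableSet_lt (by fun_prop) (by fun_prop)
  have hB : MeasurableSet {z : ℝ | q k * exp ((s + z) ^ 2 / 2) ≤ η} :=
    measurableSet_le (by fun_prop) (by fun_prop)
  have h1 : noise.real {ξ | expStat q ξ < ENNReal.ofReal (t - η)} ≤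
      noise.real {ξ | expStatExcept q k ξ < ENNReal.ofReal (t - η)} :=
    measureReal_mono fun ξ hξ => (expStatExcept_le q k ξ).trans_lt hξ
  refine (mul_le_mul_of_nonneg_right h1 measureReal_nonneg).trans ?_
  rw [← noise_real_inter k hA hB (mem_expStatExcept_lt_update q k _)]
  refine measureReal_mono ?_
  rintro ξ ⟨h2, h3⟩
  -- For `t ≤ η` the truncation in `ENNReal.ofReal` makes the first event empty.
  have hpos : 0 < t - η := by
    by_contra hcon
    have h2' : expStatExcept q k ξ < ENNReal.ofReal (t - η) := h2
    rw [ENNReal.ofReal_of_nonpos (not_lt.1 hcon)] at h2'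
    exact not_lt_bot h2'
  show shiftedStat q k s ξ < ENNReal.ofReal t
  calc shiftedStat q k s ξ ≤ ENNReal.ofReal η + expStatExcept q k ξ := by
        unfold shiftedStat; gcongr; exact h3
    _ < ENNReal.ofReal η + ENNReal.ofReal (t - η) :=
        ENNReal.add_lt_add_left ENNReal.ofReal_ne_top h2
    _ = ENNReal.ofReal t := by
        rw [← ENNReal.ofReal_add hη hpos.le]; congr 1; ring

/-- A miss forces both the other channels and the signal term below `t`, again independently.
Restoring the `k`-th noise term costs at most `η` unless that term itself exceeds `η`. -/
lemma noise_shiftedStat_lt_le (q : ℕ+ → ℝ) (k : ℕ+) (s : ℝ) {t η : ℝ} (ht : 0 ≤ t) (hη : 0 ≤ η) :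
    noise.real {ξ | shiftedStat q k s ξ < ENNReal.ofReal t} ≤
      (noise.real {ξ | expStat q ξ < ENNReal.ofReal (t + η)} +
        (gaussianReal 0 1).real {z | η < q k * exp (z ^ 2 / 2)}) *
        (gaussianReal 0 1).real {z | q k * exp ((s + z) ^ 2 / 2) < t} := by
  have hA : MeasurableSet {ξ : Obs | expStatExcept q k ξ < ENNReal.ofReal t} :=
    measurableSet_lt (by fun_prop) (by fun_prop)
  have hB : MeasurableSet {z : ℝ | q k * exp ((s + z) ^ 2 / 2) < t} :=
    measurableSet_lt (by fun_prop) (by fun_prop)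
  have hC : MeasurableSet {z : ℝ | η < q k * exp (z ^ 2 / 2)} :=
    measurableSet_lt (by fun_prop) (by fun_prop)
  have h1 : noise.real {ξ | shiftedStat q k s ξ < ENNReal.ofReal t} ≤
      noise.real {ξ | ξ ∈ {ξ : Obs | expStatExcept q k ξ < ENNReal.ofReal t} ∧
        ξ k ∈ {z : ℝ | q k * exp ((s + z) ^ 2 / 2) < t}} := by
    refine measureReal_mono fun ξ hξ => ⟨?_, ?_⟩ <;>
      change _ + expStatExcept q k ξ < ENNReal.ofReal t at hξ
    · exact lt_of_le_of_lt le_add_self hξ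
    · have : ENNReal.ofReal (q k * exp ((s + ξ k) ^ 2 / 2)) < ENNReal.ofReal t :=
        lt_of_le_of_lt le_self_add hξ
      exact (ENNReal.ofReal_lt_ofReal_iff'.1 this).1
  rw [noise_real_inter k hA hB (mem_expStatExcept_lt_update q k _)] at h1
  refine h1.trans (mul_le_mul_of_nonneg_right ?_ measureReal_nonneg)
  have hsub : {ξ : Obs | expStatExcept q k ξ < ENNReal.ofReal t} ⊆
      {ξ | expStat q ξ < ENNReal.ofReal (t + η)} ∪
        {ξ : Obs | ξ k ∈ {z : ℝ | η < q k * exp (z ^ 2 / 2)}} := by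
    intro ξ hξ
    rcases lt_or_ge η (q k * exp (ξ k ^ 2 / 2)) with h | h
    · exact Or.inr h
    · refine Or.inl ?_
      show expStat q ξ < _
      rw [expStat_eq_add q k, add_comm t, ENNReal.ofReal_add hη ht]
      exact ENNReal.add_lt_add_of_le_of_lt ENNReal.ofReal_ne_top (ENNReal.ofReal_le_ofReal h) hξ
  refine (measureReal_mono hsub).trans ((measureReal_union_le _ _).trans_eq ?_)
  congr 1
  rw [measureReal_def, noise_eval k hC]
  rfl

lemma noise_expStat_lt_of_isCriticalValue {q : ℕ+ → ℝ} {α t : ℝ} (hα : 0 ≤ α)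
    (ht : IsCriticalValue q α t) : noise.real {ξ | expStat q ξ < ENNReal.ofReal t} = 1 - α := by
  have hm : MeasurableSet {ξ | ENNReal.ofReal t ≤ expStat q ξ} :=
    measurableSet_le (by fun_prop) (by fun_prop)
  have h := probReal_compl_eq_one_sub (μ := noise) hm
  have h' : noise.real {ξ | ENNReal.ofReal t ≤ expStat q ξ} = α := by
    rw [measureReal_def]
    exact (congrArg ENNReal.toReal ht).trans (ENNReal.toReal_ofReal hα)
  rw [h'] at h
  rw [← h]
  congr 1
  ext ξ
  show expStat q ξ < ENNReal.ofReal t ↔ ¬ ENNReal.ofReal t ≤ expStat q ξ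
  exact not_le.symm

lemma IsCriticalValue.pos {q : ℕ+ → ℝ} {α t : ℝ} (hα : α < 1) (ht : IsCriticalValue q α t) :
    0 < t := by
  by_contra hcon
  have h : noise {ξ | ENNReal.ofReal t ≤ expStat q ξ} = ENNReal.ofReal α := ht
  rw [ENNReal.ofReal_of_nonpos (not_lt.1 hcon)] at h
  simp only [zero_le, Set.ofPred_true, measure_univ] at h
  have : ENNReal.ofReal α < 1 := by simpa using hα
  exact this.ne h.symm

lemma gaussian_preimage_neg {A : Set ℝ} (hA : MeasurableSet A) :
    (gaussianReal 0 1).real ((fun x => -x) ⁻¹' A) = (gaussianReal 0 1).real A := by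
  have h : (gaussianReal 0 1).map (fun x : ℝ => -x) = gaussianReal 0 1 := by
    rw [gaussianReal_map_neg, neg_zero]
  conv_rhs => rw [← h, map_measureReal_apply (by fun_prop) hA]

lemma gaussian_abs_add_le_symm (s u : ℝ) :
    (gaussianReal 0 1).real {z | |(-s) + z| ≤ u} = (gaussianReal 0 1).real {z | |s + z| ≤ u} := by
  have hm : MeasurableSet {z : ℝ | |s + z| ≤ u} := measurableSet_le (by fun_prop) (by fun_prop)
  rw [← gaussian_preimage_neg hm]
  congr 1
  ext z
  show |(-s) + z| ≤ u ↔ |s + -z| ≤ u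
  rw [← abs_neg, neg_add, neg_neg]

lemma sqrt_add_sub_sqrt_le {x y : ℝ} (hx : 0 < x) (hy : 0 ≤ y) : √(x + y) - √x ≤ y / (2 * √x) := by
  have h := Real.sqrt_pos.2 hx
  rw [le_div_iff₀ (by positivity)]
  have h1 := Real.sq_sqrt hx.le
  have h2 := Real.sq_sqrt (add_nonneg hx.le hy)
  nlinarith [sq_nonneg (√(x + y) - √x)]

lemma sqrt_sub_sqrt_sub_le {x y : ℝ} (hx : 0 < x) (hy : 0 ≤ y) (hyx : y ≤ x) :
    √x - √(x - y) ≤ y / √x := by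
  have h := Real.sqrt_pos.2 hx
  rw [le_div_iff₀ h]
  have h1 := Real.sq_sqrt hx.le
  have h2 := Real.sq_sqrt (sub_nonneg.2 hyx)
  have h3 : √(x - y) ≤ √x := Real.sqrt_le_sqrt (by linarith)
  nlinarith [mul_nonneg (Real.sqrt_nonneg (x - y)) (sub_nonneg.2 h3)]

/-- A signal with `s² ≤ 2 B` leaves its term below `η` with probability close to at least `1/2`. -/
lemma le_gaussian_shifted_le {q s η B d : ℝ} (hq : 0 < q) (hη : 0 < η) (hB : 0 < B) (hd : 0 ≤ d)
    (hdB : d ≤ B) (hηB : B - d ≤ log (η / q)) (hs : s ^ 2 ≤ 2 * B) :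
    1 / 2 - 2 * d / √(2 * B) - 2 * exp (-(B - d)) ≤
      (gaussianReal 0 1).real {z | q * exp ((s + z) ^ 2 / 2) ≤ η} := by
  set u := √(2 * (B - d)) with hu
  have hu2 : u ^ 2 = 2 * (B - d) := Real.sq_sqrt (by linarith)
  have hsub : {z : ℝ | |s + z| ≤ u} ⊆ {z | q * exp ((s + z) ^ 2 / 2) ≤ η} := by
    intro z (hz : |s + z| ≤ u)
    have h1 : (s + z) ^ 2 ≤ u ^ 2 := by
      rw [← sq_abs]; exact pow_le_pow_left₀ (abs_nonneg _) hz 2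
    show q * exp ((s + z) ^ 2 / 2) ≤ η
    rw [← le_div_iff₀' hq, ← Real.le_log_iff_exp_le (by positivity)]
    linarith
  have key : ∀ s : ℝ, 0 ≤ s → s ^ 2 ≤ 2 * B → 1 / 2 - 2 * d / √(2 * B) - 2 * exp (-(B - d)) ≤
      (gaussianReal 0 1).real {z | |s + z| ≤ u} := by
    intro s hs0 hs
    have hsB : s ≤ √(2 * B) := Real.le_sqrt_of_sq_le hs
    have hdiff := sqrt_sub_sqrt_sub_le (x := 2 * B) (y := 2 * d) (by linarith) (by linarith)
      (by linarith)
    rw [← mul_sub, ← hu] at hdiff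
    -- Since `r ≥ √(2B) - u`, every `z` in `[-u, -r]` gives `-u ≤ s + z ≤ u` whenever `0 ≤ s ≤
    -- √(2B)`.
    have h := le_gaussian_Icc (u := u) (r := 2 * d / √(2 * B)) (Real.sqrt_nonneg _) (by positivity)
    rw [hu2, show -(2 * (B - d)) / 2 = -(B - d) by ring] at h
    refine h.trans (measureReal_mono ?_)
    rintro z ⟨hz1, hz2⟩
    show |s + z| ≤ u
    rw [abs_le]
    constructor <;> linarith
  refine le_trans ?_ (measureReal_mono hsub)
  rcases le_total 0 s with h | h
  · exact key s h hs
  · rw [← gaussian_abs_add_le_symm]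
    exact key (-s) (by linarith) (by rwa [neg_sq])

/-- A signal with `s² = 2 B` raises its term to `t` with probability close to at least `1/2`. -/
lemma gaussian_shifted_lt_le {q t B d : ℝ} (hq : 0 < q) (ht : 0 < t) (hB : 0 < B) (hd : 0 ≤ d)
    (htB : log (t / q) ≤ B + d) :
    (gaussianReal 0 1).real {z | q * exp ((√(2 * B) + z) ^ 2 / 2) < t} ≤
      1 / 2 + d / √(2 * B) := by
  refine le_trans (measureReal_mono ?_) (gaussian_Iic_le (r := d / √(2 * B)) (by positivity))
  intro z (hz : q * exp ((√(2 * B) + z) ^ 2 / 2) < t)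
  have hz' : exp ((√(2 * B) + z) ^ 2 / 2) ≤ t / q := by
    rw [le_div_iff₀' hq]; exact hz.le
  rw [← Real.le_log_iff_exp_le (by positivity)] at hz'
  have h1 : √(2 * B) + z ≤ √(2 * B + 2 * d) := Real.le_sqrt_of_sq_le (by linarith)
  have h2 := sqrt_add_sub_sqrt_le (x := 2 * B) (y := 2 * d) (by linarith) (by linarith)
  rw [mul_div_mul_left _ _ two_ne_zero] at h2
  show z ≤ d / √(2 * B)
  linarith

/-! ### Asymptotics as `Λ = log n` grows, uniform over near-uniform weights -/

/-- Probability weights of order at most `exp (-Λ)` with entropy at most `Λ + O(1)`. -/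
structure NearUniform (q : ℕ+ → ℝ) (Λ C : ℝ) : Prop where
  nonneg : ∀ k, 0 ≤ q k
  hasSum : HasSum q 1
  le : ∀ k, q k ≤ C * exp (-Λ)
  summable : Summable fun k => q k * log (1 / q k)
  entropy_le : ∑' k, q k * log (1 / q k) ≤ Λ + C

lemma eventually_log_add_le (c : ℝ) : ∀ᶠ x : ℝ in atTop, log x + c ≤ x / 2 := by
  have h := Real.isLittleO_log_id_atTop.bound (show (0 : ℝ) < 1 / 4 by norm_num)
  filter_upwards [h, eventually_ge_atTop (4 * c), eventually_ge_atTop 0] with x h1 h2 h3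
  rw [id, Real.norm_eq_abs, Real.norm_of_nonneg h3] at h1
  linarith [le_abs_self (log x)]

lemma eventually_log_add_le_sqrt (c : ℝ) {ε : ℝ} (hε : 0 < ε) :
    ∀ᶠ x : ℝ in atTop, 2 * log x + c ≤ ε * √x := by
  have h := (Real.isLittleO_log_id_atTop.bound (show (0 : ℝ) < ε / 8 by positivity))
  filter_upwards [tendsto_sqrt_atTop.eventually h, eventually_gt_atTop 0,
    tendsto_sqrt_atTop.eventually (eventually_ge_atTop (2 * c / ε))] with x h1 h2 h3
  rw [id, Real.norm_eq_abs, Real.norm_of_nonneg (Real.sqrt_nonneg x)] at h1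
  rw [Real.log_sqrt h2.le] at h1
  rw [div_le_iff₀ hε] at h3
  linarith [le_abs_self (log x / 2)]

lemma eventually_half_le_log {C : ℝ} (hC : 0 < C) {a : ℝ} (ha : 0 < a) :
    ∀ᶠ Λ : ℝ in atTop, ∀ q : ℝ, 0 < q → q ≤ C * exp (-Λ) → Λ / 2 ≤ log (a / √Λ / q) := by
  filter_upwards [eventually_log_add_le (2 * (log C - log a)), eventually_gt_atTop 0]
    with Λ h1 hΛ q hq0 hq
  have hs : 0 < √Λ := Real.sqrt_pos.2 hΛ
  have h2 : log q ≤ log C - Λ := by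
    have := Real.log_le_log hq0 hq
    rwa [Real.log_mul hC.ne' (exp_pos _).ne', Real.log_exp, ← sub_eq_add_neg] at this
  rw [Real.log_div (by positivity) hq0.ne', Real.log_div ha.ne' hs.ne', Real.log_sqrt hΛ.le]
  linarith

/-- The statistic of the Bayes test does not concentrate at the scale `1 / √Λ`. -/
theorem exists_noise_expStat_mem_Ico_le {C ε : ℝ} (hC : 0 < C) (hε : 0 < ε) :
    ∃ δ : ℝ, 0 < δ ∧ ∀ᶠ Λ : ℝ in atTop, ∀ q, NearUniform q Λ C → ∀ x : ℝ,
      noise.real {ξ | ENNReal.ofReal x ≤ expStat q ξ ∧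
        expStat q ξ < ENNReal.ofReal (x + δ / √Λ)} ≤ ε := by
  set c : ℝ := (√(2 * π))⁻¹ * exp (-3 / 2) / √2 with hc
  have hc0 : 0 < c := by positivity
  obtain ⟨κ, hκ0, hκ⟩ : ∃ κ : ℝ, 0 < κ ∧ exp (-(c / (κ * √2) / 2)) ≤ ε / 2 := by
    have ht : Tendsto (fun y : ℝ => exp (-(c / √2 / 2 * y))) atTop (𝓝 0) :=
      Real.tendsto_exp_neg_atTop_nhds_zero.comp
        (tendsto_id.const_mul_atTop (by positivity))
    obtain ⟨y, hy, hy0⟩ := ((ht.eventually_le_const (half_pos hε)).and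
      (eventually_gt_atTop 0)).exists
    refine ⟨y⁻¹, by positivity, ?_⟩
    have e : c / (y⁻¹ * √2) / 2 = c / √2 / 2 * y := by field_simp
    rwa [e]
  -- With level `h = κ/√Λ` the large-term bound becomes `δ/κ²`, so this `δ` yields exactly `ε/2`;
  -- the other half comes from the choice of `κ`.
  refine ⟨κ ^ 2 * (ε / 2), by positivity, ?_⟩
  filter_upwards [eventually_half_le_log hC hκ0, eventually_ge_atTop 2, eventually_ge_atTop C,
    eventually_ge_atTop (κ ^ 2)] with Λ h1 h2 h3 h4 q hq x
  have hΛ : 0 < Λ := by linarith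
  have hs : 0 < √Λ := Real.sqrt_pos.2 hΛ
  have hκΛ : κ / √Λ ≤ 1 := by
    rw [div_le_one hs]; exact Real.le_sqrt_of_sq_le h4
  have hmain := noise_expStat_mem_Ico_le hq.nonneg hq.hasSum (m := 2 * Λ) (h := κ / √Λ)
    (l := Λ / 2) (η := κ ^ 2 * (ε / 2) / √Λ) (by positivity) hq.summable
    (hq.entropy_le.trans (by linarith)) (by positivity) hκΛ (by linarith)
    (fun k hk => h1 (q k) hk (hq.le k)) (by positivity) x
  refine hmain.trans ?_
  have e1 : κ / √Λ * √(2 * Λ) = κ * √2 := by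
    rw [Real.sqrt_mul (by norm_num)]; field_simp
  have e2 : κ ^ 2 * (ε / 2) / √Λ / (κ / √Λ) ^ 2 / √(2 * (Λ / 2)) = ε / 2 := by
    rw [show 2 * (Λ / 2) = Λ by ring]
    field_simp
  rw [e1, e2, ← hc]
  linarith

/-- The critical values of the Bayes test grow at most linearly in `Λ`. -/
theorem eventually_isCriticalValue_le (C : ℝ) {α : ℝ} (hα0 : 0 < α) (hα1 : α < 1) :
    ∀ᶠ Λ : ℝ in atTop, ∀ q, NearUniform q Λ C → ∀ t, IsCriticalValue q α t →
      t ≤ 4 / α * Λ := by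
  filter_upwards [eventually_ge_atTop (1 / 2 + log (4 / α) + C), eventually_gt_atTop 0]
    with Λ h1 hΛ q hq t ht
  have ht0 := ht.pos hα1
  -- Truncating at `4/α` spends `α/2` on large terms, so the Markov part must supply the other
  -- `α/2`, which bounds `t`.
  have hA : 1 ≤ 4 / α := by rw [le_div_iff₀ hα0]; linarith
  have h := noise_expStat_ge_le hq.nonneg hq.hasSum hq.summable hq.entropy_le hA ht0
  have h0 : 0 ≤ ∑' k, q k * log (1 / q k) := tsum_nonneg fun k => by
    rcases (hq.nonneg k).eq_or_lt' with hk | hk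
    · simp [hk]
    · exact mul_nonneg hk.le (Real.log_nonneg ((one_le_div hk).2
        (le_hasSum hq.hasSum k fun i _ => hq.nonneg i)))
  have h0' : 0 ≤ 1 / 2 + log (4 / α) + (Λ + C) := by
    linarith [Real.log_nonneg hA, hq.entropy_le]
  rw [show noise {ξ | ENNReal.ofReal t ≤ expStat q ξ} = ENNReal.ofReal α from ht,
    ← ENNReal.ofReal_add (by positivity) (by positivity),
    ENNReal.ofReal_le_ofReal_iff (by positivity)] at h
  have h2 : 2 / (4 / α) = α / 2 := by field_simp; norm_num
  rw [h2] at h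
  have h3 : α / 2 ≤ (1 / 2 + log (4 / α) + (Λ + C)) / t := by linarith
  rw [le_div_iff₀ ht0] at h3
  have h4 : α * t ≤ 4 * Λ := by linarith
  rw [div_mul_eq_mul_div, le_div_iff₀ hα0]
  linarith

/-- Compares the logarithmic threshold for a term to reach `a/√Λ` with the side of the box: they
differ by a quantity free of `q`. -/
lemma log_one_div_mul_sqrt {q Λ : ℝ} (hq : 0 < q) (hΛ : 0 < Λ) {a : ℝ} (ha : 0 < a) :
    log (a / √Λ / q) = log (1 / (q * √(π * Λ))) + log (a * √π) := by
  have h1 : 0 < √(π * Λ) := Real.sqrt_pos.2 (mul_pos pi_pos hΛ)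
  have h2 : 0 < √π := Real.sqrt_pos.2 pi_pos
  rw [← Real.log_mul (by positivity) (by positivity), Real.sqrt_mul pi_pos.le]
  congr 1
  field_simp

lemma eventually_half_le_log_side {C : ℝ} (hC : 0 < C) :
    ∀ᶠ Λ : ℝ in atTop, ∀ q : ℝ, 0 < q → q ≤ C * exp (-Λ) →
      Λ / 2 ≤ log (1 / (q * √(π * Λ))) := by
  have h2 : 0 < √π := Real.sqrt_pos.2 pi_pos
  filter_upwards [eventually_half_le_log hC (a := (√π)⁻¹) (by positivity), eventually_gt_atTop 0]
    with Λ h hΛ q hq0 hq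
  have h3 := h q hq0 hq
  rwa [log_one_div_mul_sqrt hq0 hΛ (by positivity), inv_mul_cancel₀ h2.ne', Real.log_one,
    add_zero] at h3

/-- All signals in the parallelepiped are missed with probability at least about `(1 - α) / 2`. -/
theorem eventually_le_noise_shiftedStat_lt {C α ε : ℝ} (hC : 0 < C) (hα0 : 0 < α) (hε : 0 < ε) :
    ∀ᶠ Λ : ℝ in atTop, ∀ q, NearUniform q Λ C → ∀ t, IsCriticalValue q α t → ∀ k s,
      (0 < q k → s ^ 2 ≤ 2 * log (1 / (q k * √(π * Λ)))) →
      (1 - α) / 2 - 2 * ε ≤ noise.real {ξ | shiftedStat q k s ξ < ENNReal.ofReal t} := by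
  obtain ⟨δ, hδ, hconc⟩ := exists_noise_expStat_mem_Ico_le hC hε
  set d := |log (δ * √π)| with hd
  have hexp : Tendsto (fun Λ : ℝ => 2 * exp (-(1 / 2 * Λ - d))) atTop (𝓝 0) := by
    rw [← mul_zero (2 : ℝ)]
    exact (Real.tendsto_exp_neg_atTop_nhds_zero.comp (tendsto_atTop_add_const_right _ (-d)
      (tendsto_id.const_mul_atTop (by norm_num : (0 : ℝ) < 1 / 2)))).const_mul 2
  have hsq : Tendsto (fun Λ : ℝ => 2 * d / √Λ) atTop (𝓝 0) :=
    tendsto_sqrt_atTop.const_div_atTop _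
  filter_upwards [hconc, eventually_half_le_log_side hC, eventually_gt_atTop (2 * d),
    eventually_gt_atTop 0, hexp.eventually_le_const (half_pos hε),
    hsq.eventually_le_const (half_pos hε)] with Λ h1 h2 h3 hΛ h4 h5 q hq t ht k s hs
  have hsΛ : 0 < √Λ := Real.sqrt_pos.2 hΛ
  have hη : 0 < δ / √Λ := by positivity
  have hG : 1 / 2 - ε ≤ (gaussianReal 0 1).real {z | q k * exp ((s + z) ^ 2 / 2) ≤ δ / √Λ} := by
    rcases (hq.nonneg k).eq_or_lt' with hk | hk
    · simp only [hk, zero_mul, hη.le, Set.ofPred_true, probReal_univ]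
      linarith
    · have hB := h2 (q k) hk (hq.le k)
      have hd0 : 0 ≤ d := abs_nonneg _
      have h6 := le_gaussian_shifted_le (s := s) (d := d) hk hη (by linarith) hd0 (by linarith)
        (by rw [log_one_div_mul_sqrt hk hΛ hδ]
            linarith [neg_abs_le (log (δ * √π))]) (hs hk)
      have h7 : 2 * d / √(2 * log (1 / (q k * √(π * Λ)))) ≤ 2 * d / √Λ := by
        gcongr; linarith
      have h8 : exp (-(log (1 / (q k * √(π * Λ))) - d)) ≤ exp (-(1 / 2 * Λ - d)) := by
        rw [exp_le_exp]; linarith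
      linarith
  have hP : 1 - α - ε ≤ noise.real {ξ | expStat q ξ < ENNReal.ofReal (t - δ / √Λ)} := by
    have h6 := noise_expStat_lt_of_isCriticalValue hα0.le ht
    have h7 := h1 q hq (t - δ / √Λ)
    rw [sub_add_cancel] at h7
    have hsub : {ξ | expStat q ξ < ENNReal.ofReal t} ⊆
        {ξ | expStat q ξ < ENNReal.ofReal (t - δ / √Λ)} ∪
        {ξ | ENNReal.ofReal (t - δ / √Λ) ≤ expStat q ξ ∧ expStat q ξ < ENNReal.ofReal t} := by
      intro ξ hξ
      rcases lt_or_ge (expStat q ξ) (ENNReal.ofReal (t - δ / √Λ)) with h | h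
      · exact Or.inl h
      · exact Or.inr ⟨h, hξ⟩
    have h8 := (measureReal_mono (μ := noise) hsub).trans (measureReal_union_le _ _)
    linarith
  refine le_trans ?_ (le_noise_shiftedStat_lt q k s t hη.le)
  set P := noise.real {ξ | expStat q ξ < ENNReal.ofReal (t - δ / √Λ)}
  have hP0 : 0 ≤ P := measureReal_nonneg
  have hP1 : P ≤ 1 := measureReal_le_one
  have h9 := mul_le_mul_of_nonneg_left hG hP0
  nlinarith

/-- A signal at the boundary of the parallelepiped is missed with probability at most about
`(1 - α) / 2`. -/
theorem eventually_noise_shiftedStat_lt_le {C α ε : ℝ} (hC : 0 < C) (hα0 : 0 < α) (hα1 : α < 1)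
    (hε : 0 < ε) :
    ∀ᶠ Λ : ℝ in atTop, ∀ q, NearUniform q Λ C → ∀ t, IsCriticalValue q α t → ∀ k, 0 < q k →
      noise.real {ξ | shiftedStat q k √(2 * log (1 / (q k * √(π * Λ)))) ξ < ENNReal.ofReal t}
        ≤ (1 - α) / 2 + 3 * ε := by
  obtain ⟨δ, hδ, hconc⟩ := exists_noise_expStat_mem_Ico_le hC hε
  set d := |log (δ * √π)| with hd
  have hexp : Tendsto (fun Λ : ℝ => 2 * exp (-(1 / 2 * Λ - d))) atTop (𝓝 0) := by
    rw [← mul_zero (2 : ℝ)]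
    exact (Real.tendsto_exp_neg_atTop_nhds_zero.comp (tendsto_atTop_add_const_right _ (-d)
      (tendsto_id.const_mul_atTop (by norm_num : (0 : ℝ) < 1 / 2)))).const_mul 2
  filter_upwards [hconc, eventually_half_le_log_side hC, eventually_gt_atTop (2 * d),
    eventually_ge_atTop 1, hexp.eventually_le_const hε, eventually_isCriticalValue_le C hα0 hα1,
    eventually_log_add_le_sqrt (log (4 / α * √π)) hε] with Λ h1 h2 h3 hΛ1 h4 h5 h10 q hq t ht k hk
  have hΛ : 0 < Λ := by linarith
  have hsΛ : 0 < √Λ := Real.sqrt_pos.2 hΛ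
  have hη : 0 < δ / √Λ := by positivity
  have ht0 := ht.pos hα1
  have htΛ := h5 q hq t ht
  have hB := h2 (q k) hk (hq.le k)
  have hspi : 1 ≤ √π := Real.one_le_sqrt.2 (by linarith [pi_gt_three])
  have hα4 : 1 ≤ 4 / α := by rw [le_div_iff₀ hα0]; linarith
  set B := log (1 / (q k * √(π * Λ))) with hBdef
  -- Writing `t = (t√Λ)/√Λ` and using `t ≤ 4Λ/α`, the threshold for reaching `t` exceeds the side
  -- `B` by at most `D = O(log Λ)`, negligible against `√(2B) ≥ √Λ`.
  set D := log (4 / α * Λ * √Λ * √π) with hD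
  have hD0 : 0 ≤ D := by
    apply Real.log_nonneg
    have : 1 ≤ √Λ := Real.one_le_sqrt.2 hΛ1
    exact one_le_mul_of_one_le_of_one_le (one_le_mul_of_one_le_of_one_le
      (one_le_mul_of_one_le_of_one_le hα4 hΛ1) this) hspi
  have hDle : D ≤ ε * √Λ := by
    have : D = log Λ + log Λ / 2 + log (4 / α * √π) := by
      rw [hD, show 4 / α * Λ * √Λ * √π = Λ * √Λ * (4 / α * √π) by ring,
        Real.log_mul (by positivity) (by positivity), Real.log_mul hΛ.ne' hsΛ.ne',
        Real.log_sqrt hΛ.le]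
    linarith [Real.log_nonneg hΛ1]
  have hG : (gaussianReal 0 1).real {z | q k * exp ((√(2 * B) + z) ^ 2 / 2) < t} ≤ 1 / 2 + ε := by
    have htq : log (t / q k) ≤ B + D := by
      have e : t / q k = t * √Λ / √Λ / q k := by field_simp
      rw [e, log_one_div_mul_sqrt hk hΛ (by positivity)]
      have : log (t * √Λ * √π) ≤ D := Real.log_le_log (by positivity) (by gcongr)
      linarith
    refine (gaussian_shifted_lt_le hk ht0 (by linarith) hD0 htq).trans ?_
    have : D / √(2 * B) ≤ ε := by
      calc D / √(2 * B) ≤ D / √Λ := by gcongr; linarith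
        _ ≤ ε := by rwa [div_le_iff₀ hsΛ]
    linarith
  have hT : (gaussianReal 0 1).real {z | δ / √Λ < q k * exp (z ^ 2 / 2)} ≤ ε := by
    have hlog : Λ / 2 - d ≤ log (δ / √Λ / q k) := by
      rw [log_one_div_mul_sqrt hk hΛ hδ]
      linarith [neg_abs_le (log (δ * √π))]
    have hqη : q k ≤ δ / √Λ := by
      by_contra hcon
      have := Real.log_nonpos (x := δ / √Λ / q k) (by positivity)
        ((div_le_one hk).2 (not_le.1 hcon).le)
      linarith
    have hsub : {z : ℝ | δ / √Λ < q k * exp (z ^ 2 / 2)} ⊆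
        {z | √(2 * log (δ / √Λ / q k)) ≤ |z|} := fun z hz =>
      (le_mul_exp_iff hk hqη).1 (le_of_lt hz)
    refine (measureReal_mono hsub).trans ((gaussian_abs_ge_le (Real.sqrt_nonneg _)).trans ?_)
    refine le_trans ?_ h4
    gcongr
    rw [Real.sq_sqrt (by linarith)]
    linarith
  have hP : noise.real {ξ | expStat q ξ < ENNReal.ofReal (t + δ / √Λ)} ≤ 1 - α + ε := by
    have h6 := noise_expStat_lt_of_isCriticalValue hα0.le ht
    have h7 := h1 q hq t
    have hsub : {ξ | expStat q ξ < ENNReal.ofReal (t + δ / √Λ)} ⊆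
        {ξ | expStat q ξ < ENNReal.ofReal t} ∪
        {ξ | ENNReal.ofReal t ≤ expStat q ξ ∧ expStat q ξ < ENNReal.ofReal (t + δ / √Λ)} := by
      intro ξ hξ
      rcases lt_or_ge (expStat q ξ) (ENNReal.ofReal t) with h | h
      · exact Or.inl h
      · exact Or.inr ⟨h, hξ⟩
    have h8 := (measureReal_mono (μ := noise) hsub).trans (measureReal_union_le _ _)
    linarith
  refine (noise_shiftedStat_lt_le q k _ ht0.le hη.le).trans ?_
  set G := (gaussianReal 0 1).real {z | q k * exp ((√(2 * B) + z) ^ 2 / 2) < t}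
  have hG0 : 0 ≤ G := measureReal_nonneg
  have hG1 : G ≤ 1 := measureReal_le_one
  have h9 : (noise.real {ξ | expStat q ξ < ENNReal.ofReal (t + δ / √Λ)} +
      (gaussianReal 0 1).real {z | δ / √Λ < q k * exp (z ^ 2 / 2)}) * G ≤ (1 - α + ε + ε) * G := by
    gcongr
  have h11 : (1 - α) * G ≤ (1 - α) * (1 / 2 + ε) := by gcongr
  nlinarith

/-! ### Return to the prior; comparison of sides; the worst signal -/

lemma nearUniform_prior {p : ℝ → ℝ} {n : ℕ} {C₁ C₂ : ℝ} (hn : 0 < n)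
    (hp : ∀ x, 0 < x → 0 ≤ p x) (hs : Summable fun s : ℕ+ => p ((s : ℝ) / n))
    (hs0 : 0 < ∑' s : ℕ+, p ((s : ℝ) / n)) (hC : ∀ k, prior p n k ≤ C₁ / n)
    (hent : Summable fun k : ℕ+ => prior p n k * log (1 / prior p n k))
    (hent' : ∑' k : ℕ+, prior p n k * log (1 / prior p n k) ≤ log n + C₂) :
    NearUniform (prior p n) (log n) (max 1 (max C₁ C₂)) where
  nonneg k := div_nonneg (hp _ (by
    have : (0 : ℝ) < (k : ℝ) := by exact_mod_cast k.pos
    positivity)) hs0.le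
  hasSum := by
    have := hs.hasSum.div_const (∑' s : ℕ+, p ((s : ℝ) / n))
    rwa [div_self hs0.ne'] at this
  le k := by
    rw [Real.exp_neg, Real.exp_log (by exact_mod_cast hn), ← div_eq_mul_inv]
    refine (hC k).trans ?_
    gcongr
    exact (le_max_left _ _).trans (le_max_right _ _)
  summable := hent
  entropy_le := hent'.trans (by gcongr; exact (le_max_right _ _).trans (le_max_right _ _))

lemma bayesSideSq_eq {q : ℕ+ → ℝ} {σ : ℝ} {n : ℕ} {k : ℕ+} :
    bayesSideSq q σ n k = 2 * σ ^ 2 * log (1 / (q k * √(π * log n))) := rfl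

/-- The terms with `qₖ` cancel, so the remainder does not depend on `k` and uniformity is automatic.
-/
lemma mapSideSq_sub_bayesSideSq {q : ℕ+ → ℝ} {σ α : ℝ} {n : ℕ} {k : ℕ+} (hα : 0 < α)
    (hq : 0 < q k) (hn : 1 < n) :
    mapSideSq q σ α n k - bayesSideSq q σ n k - 2 * σ ^ 2 * log (1 / α) =
      σ ^ 2 * (log (log n) - log (log (n / (√π * α)))) := by
  have hlog : 0 < log (n : ℝ) := Real.log_pos (by exact_mod_cast hn)
  have hpi := pi_pos
  have hspi : 0 < √π := Real.sqrt_pos.2 hpi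
  have hsl : 0 < √(π * log n) := Real.sqrt_pos.2 (by positivity)
  rw [mapSideSq, bayesSideSq]
  simp only [one_div, Real.log_inv]
  rw [Real.log_mul hspi.ne' hα.ne', Real.log_mul hq.ne' hsl.ne', Real.log_sqrt (x := π * log n) (by positivity),
    Real.log_mul hpi.ne' hlog.ne', Real.log_sqrt hpi.le]
  ring

lemma tendsto_log_log_sub_log_log_div {a : ℝ} (ha : 0 < a) :
    Tendsto (fun n : ℕ => log (log n) - log (log (n / a))) atTop (𝓝 0) := by
  have hlog : Tendsto (fun n : ℕ => log (n : ℝ)) atTop atTop :=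
    Real.tendsto_log_atTop.comp tendsto_natCast_atTop_atTop
  have h1 : Tendsto (fun n : ℕ => 1 - log a / log n) atTop (𝓝 1) := by
    simpa using (tendsto_const_nhds (x := (1 : ℝ))).sub (hlog.const_div_atTop (log a))
  have h2 : Tendsto (fun n : ℕ => -log (1 - log a / log n)) atTop (𝓝 0) := by
    simpa using (h1.log one_ne_zero).neg
  refine h2.congr' ?_
  filter_upwards [hlog.eventually_gt_atTop 0, hlog.eventually_gt_atTop (log a),
    eventually_gt_atTop 0] with n hn1 hn2 hn3
  have hn : (0 : ℝ) < n := by exact_mod_cast hn3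
  rw [Real.log_div hn.ne' ha.ne', ← Real.log_div hn1.ne' (by linarith), ← Real.log_inv]
  congr 1
  have : log (n : ℝ) - log a ≠ 0 := by linarith
  field_simp

/-- The worst error of the second kind over the parallelepiped is close to `(1 - α) / 2`. -/
theorem eventually_abs_sInf_secondKindError_sub_le {σ C α ε : ℝ} (hσ : 0 < σ) (hC : 0 < C)
    (hα0 : 0 < α) (hα1 : α < 1) (hε : 0 < ε) :
    ∀ᶠ n : ℕ in atTop, ∀ q, NearUniform q (log n) C → ∀ t, IsCriticalValue q α t →
      |sInf (secondKindError σ (bayesTest q σ t) '' (bayesBox q σ n ∩ signals)) - (1 - α) / 2|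
        ≤ 3 * ε := by
  have hlog : Tendsto (fun n : ℕ => log (n : ℝ)) atTop atTop :=
    Real.tendsto_log_atTop.comp tendsto_natCast_atTop_atTop
  filter_upwards [hlog.eventually (eventually_le_noise_shiftedStat_lt (α := α) hC hα0 hε),
    hlog.eventually (eventually_noise_shiftedStat_lt_le hC hα0 hα1 hε),
    hlog.eventually (eventually_half_le_log_side hC), hlog.eventually_gt_atTop 0]
    with n hlow hup hside hn q hq t ht
  obtain ⟨k, hk⟩ : ∃ k, 0 < q k := by
    by_contra hcon
    push Not at hcon
    have : q = 0 := funext fun k => le_antisymm (hcon k) (hq.nonneg k)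
    have h1 := hq.hasSum
    rw [this] at h1
    exact zero_ne_one (hasSum_zero.unique h1)
  have hsidek : ∀ i, 0 < q i → 0 ≤ log (1 / (q i * √(π * log n))) := fun i hi => by
    have := hside (q i) hi (hq.le i)
    linarith
  set s := √(2 * log (1 / (q k * √(π * log n)))) with hs
  -- A signal on the boundary in any channel of positive weight already attains the infimum
  -- asymptotically.
  set S : Obs := Pi.single k (σ * s) with hS
  have hSk : S ∈ channelSignals k := fun i hi => Pi.single_eq_of_ne hi _
  have hSmem : S ∈ bayesBox q σ n ∩ signals := by
    refine ⟨fun i hi => ?_, Set.mem_iUnion.2 ⟨k, hSk⟩⟩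
    rw [bayesSideSq_eq]
    by_cases hik : i = k
    · subst hik
      rw [hS, Pi.single_eq_same, mul_pow, hs, Real.sq_sqrt (by have := hsidek i hi; positivity)]
      exact le_of_eq (by ring)
    · rw [hSk i hik, zero_pow two_ne_zero]
      have := hsidek i hi
      positivity
  have hlower : ∀ b ∈ secondKindError σ (bayesTest q σ t) '' (bayesBox q σ n ∩ signals),
      (1 - α) / 2 - 2 * ε ≤ b := by
    rintro _ ⟨T, ⟨hT1, hT2⟩, rfl⟩
    obtain ⟨i, hi⟩ := Set.mem_iUnion.1 hT2
    rw [secondKindError_channelSignal q hσ t hi]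
    refine hlow q hq t ht i _ fun hqi => ?_
    have h1 : T i ^ 2 ≤ bayesSideSq q σ n i := hT1 i hqi
    rw [bayesSideSq_eq] at h1
    rw [div_pow, div_le_iff₀ (by positivity)]
    linarith
  have hne : (secondKindError σ (bayesTest q σ t) '' (bayesBox q σ n ∩ signals)).Nonempty :=
    ⟨_, S, hSmem, rfl⟩
  have h1 := le_csInf hne hlower
  have h2 := csInf_le ⟨_, hlower⟩ ⟨S, hSmem, rfl⟩
  have h3 := hup q hq t ht k hk
  rw [secondKindError_channelSignal q hσ t hSk, hS, Pi.single_eq_same,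
    mul_div_cancel_left₀ _ hσ.ne'] at h2
  rw [abs_le]
  constructor <;> linarith

end Multichannel

theorem theorem6
    (σ : ℝ) (hσ : 0 < σ) (α : ℝ) (hα0 : 0 < α) (hα1 : α < 1)
    -- the prior shape on the half-line: a bounded probability density with finite entropy
    (p : ℝ → ℝ) (hp_nonneg : ∀ x, 0 < x → 0 ≤ p x)
    (hp_bdd : ∃ M : ℝ, ∀ x, 0 < x → p x ≤ M)
    (hp_int : ∫ x in Set.Ioi (0 : ℝ), p x = 1)
    (hp_entropy : IntegrableOn (fun x => p x * Real.log (1 / p x)) (Set.Ioi (0 : ℝ)))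
    -- for large n the prior probabilities are well defined
    (hsum : ∀ᶠ n : ℕ in atTop, Summable (fun s : ℕ+ => p ((s : ℝ) / n)) ∧
      0 < ∑' s : ℕ+, p ((s : ℝ) / n))
    -- they have the order 1/n, and their entropy is at most log n + C
    (horder : ∃ C : ℝ, ∀ᶠ n : ℕ in atTop, ∀ k : ℕ+, Multichannel.prior p n k ≤ C / n)
    (hentropy : ∃ C : ℝ, ∀ᶠ n : ℕ in atTop,
      Summable (fun k : ℕ+ =>
        Multichannel.prior p n k * Real.log (1 / Multichannel.prior p n k)) ∧
      ∑' k : ℕ+, Multichannel.prior p n k * Real.log (1 / Multichannel.prior p n k)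
        ≤ Real.log n + C)
    -- the critical values of the Bayes test
    (t : ℕ → ℝ)
    (ht : ∀ᶠ n : ℕ in atTop, Multichannel.IsCriticalValue (Multichannel.prior p n) α (t n)) :
    (∃ L : ℝ,
      Tendsto
        (fun n : ℕ => sInf (Multichannel.secondKindError σ
            (Multichannel.bayesTest (Multichannel.prior p n) σ (t n)) ''
          (Multichannel.bayesBox (Multichannel.prior p n) σ n ∩ Multichannel.signals)))
        atTop (𝓝 L) ∧
      (1 - α) / 2 ≤ L) ∧
    (∀ ε : ℝ, 0 < ε → ∀ᶠ n : ℕ in atTop, ∀ k : ℕ+, 0 < Multichannel.prior p n k →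
      |Multichannel.mapSideSq (Multichannel.prior p n) σ α n k
          - Multichannel.bayesSideSq (Multichannel.prior p n) σ n k
        - 2 * σ ^ 2 * Real.log (1 / α)| < ε) := by
  obtain ⟨C₁, hC₁⟩ := horder
  obtain ⟨C₂, hC₂⟩ := hentropy
  set C : ℝ := max 1 (max C₁ C₂) with hC
  have hC0 : 0 < C := lt_of_lt_of_le one_pos (le_max_left _ _)
  have hnear : ∀ᶠ n : ℕ in atTop,
      Multichannel.NearUniform (Multichannel.prior p n) (Real.log n) C := by
    filter_upwards [hsum, hC₁, hC₂, eventually_gt_atTop 0] with n h1 h2 h3 hn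
    exact Multichannel.nearUniform_prior hn hp_nonneg h1.1 h1.2 h2 h3.1 h3.2
  -- The limit is the claimed lower bound itself.
  refine ⟨⟨(1 - α) / 2, ?_, le_rfl⟩, ?_⟩
  · rw [Metric.tendsto_nhds]
    intro ε hε
    filter_upwards [Multichannel.eventually_abs_sInf_secondKindError_sub_le hσ hC0 hα0 hα1
      (show 0 < ε / 6 by positivity), hnear, ht] with n h1 h2 h3
    rw [Real.dist_eq]
    have := h1 _ h2 _ h3
    linarith
  · intro ε hε
    have hspi : 0 < Real.sqrt Real.pi := Real.sqrt_pos.2 Real.pi_pos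
    have h := (Multichannel.tendsto_log_log_sub_log_log_div
      (show 0 < Real.sqrt Real.pi * α by positivity)).const_mul (σ ^ 2)
    rw [mul_zero] at h
    filter_upwards [(Metric.tendsto_nhds.1 h) ε hε, eventually_gt_atTop 1] with n h1 hn k hk
    rw [Multichannel.mapSideSq_sub_bayesSideSq hα0 hk hn]
    simpa [Real.dist_eq] using h1
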